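/- Let $X$ be a real random variable on a probability space, with law $\mu_X$, whose moment generating function is finite near zero: there is $t_0>0$ with $\mathbb E\,e^{tX}<\infty$ for all $t\in(-t_0,t_0)$. Let $m=\mathbb E[X]$ and let $q(x)=\delta x^2+\beta x+\gamma$ with $\delta,\beta,\gamma\in\mathbb R$ (polynomial of degree at most two). (a) (Continuous Pearson case.) Suppose $X$ has a density $f\ge 0$ with $$\int_{-\infty}^x (m-t)f(t)\,dt=q(x)f(x)\qquad\text{for all }x\in\mathbb R .$$ Let $(r,s)$ be the open support interval of $X$, i.e. the interior of $\{x: f(x)>0\}$. Let $g_1,g_2\in L^2(\mathbb R,\mu_X)$ be infinitely differentiable on $(r,s)$ with $$\mathbb E\bigl[q^k(X)\,|g_i^{(k)}(X)|\bigr]<\infty,\qquad k=0,1,2,\ldots,\ i=1,2 .$$ Then $$\operatorname{Cov}[g_1(X),g_2(X)]=\sum_{k=1}^\infty \frac{\mathbb E[q^k(X)g_1^{(k)}(X)]\;\mathbb E[q^k(X)g_2^{(k)}(X)]}{k!\;\mathbb E[q^k(X)]\;\prod_{j=k-1}^{2k-2}(1-j\delta)},$$ where the series converges (absolutely). (b)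 (Discrete Pearson, or Ord, case.) Suppose $X$ takes values in $\{0,1,2,\ldots\}$ and its probability function $p(x)=\Pr(X=x)$ satisfies $$\sum_{j=0}^x (m-j)p(j)=q(x)p(x),\qquad x=0,1,2,\ldots .$$ Write $\Delta g(x)=g(x+1)-g(x)$, $\Delta^k=\Delta\circ\Delta^{k-1}$, $\Delta^0 g=g$, and $q^{[k]}(x)=q(x)q(x+1)\cdots q(x+k-1)$, $q^{[0]}=1$. Let $g_1,g_2:\{0,1,2,\ldots\}\to\mathbb R$ satisfy $\mathbb E[g_i(X)^2]<\infty$ and $$\mathbb E\bigl[q^{[k]}(X)\,|\Delta^k g_i(X)|\bigr]<\infty,\qquad k=0,1,2,\ldots,\ i=1,2 .$$ Then $$\operatorname{Cov}[g_1(X),g_2(X)]=\sum_{k=1}^\infty \frac{\mathbb E[q^{[k]}(X)\Delta^k g_1(X)]\;\mathbb E[q^{[k]}(X)\Delta^k g_2(X)]}{k!\;\mathbb E[q^{[k]}(X)]\;\prod_{j=k-1}^{2k-2}(1-j\delta)},$$ where each term with $\mathbb E[q^{[k]}(X)]=0$ is read as zero and the series converges (absolutely). -/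

import Mathlib

open MeasureTheory ProbabilityTheory

namespace Pearson

/-- The quadratic `q(x) = δ x² + β x + γ` (of degree at most two). -/
def quad (δ β γ x : ℝ) : ℝ := δ * x ^ 2 + β * x + γ

/-- The ascending product `q^{[k]}(x) = q(x) q(x+1) ⋯ q(x+k-1)`, with `q^{[0]} = 1`. -/
def ascQuad (δ β γ : ℝ) (k : ℕ) (x : ℝ) : ℝ :=
  ∏ i ∈ Finset.range k, quad δ β γ (x + i)

/-- `Y` has a finite moment generating function in a neighbourhood of zero. -/
def FiniteMGFNearZero {Ω : Type*} [MeasurableSpace Ω] (Y : Ω → ℝ) (P : Measure Ω) : Prop :=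
  ∃ t₀ : ℝ, 0 < t₀ ∧ ∀ t ∈ Set.Ioo (-t₀) t₀, Integrable (fun ω => Real.exp (t * Y ω)) P

/-- The real random variable `X` has density `f` and finite mean `m`, and
`∫_{-∞}^x (m - t) f(t) dt = q(x) f(x)` for every real `x`, where `q(x) = δ x² + β x + γ`. -/
structure IsContinuous {Ω : Type*} [MeasurableSpace Ω] (P : Measure Ω)
    (X : Ω → ℝ) (f : ℝ → ℝ) (δ β γ : ℝ) : Prop where
  aemeasurable : AEMeasurable X P
  integrable : Integrable X P
  measurable_density : Measurable f
  density_nonneg : ∀ x, 0 ≤ f x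
  law : P.map X = volume.withDensity (fun x => ENNReal.ofReal (f x))
  identity : ∀ x : ℝ, ∫ t in Set.Iic x, ((∫ ω, X ω ∂P) - t) * f t = quad δ β γ x * f x

/-- The open support interval `(r, s)` of the density. Under the Pearson identity the set
`{f > 0}` is an open interval up to points at which `q` vanishes, where the identity leaves the
value of `f` free; taking the interior discards these. -/
def openSupport (f : ℝ → ℝ) : Set ℝ := interior {x | 0 < f x}

/-- The random variable `X` with values in `{0, 1, 2, …}` has finite mean `m`, and its probability
function `p` satisfies `∑_{j=0}^x (m - j) p(j) = q(x) p(x)` for `x = 0, 1, 2, …`, where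
`q(x) = δ x² + β x + γ`. -/
structure IsDiscrete {Ω : Type*} [MeasurableSpace Ω] (P : Measure Ω)
    (X : Ω → ℕ) (δ β γ : ℝ) : Prop where
  aemeasurable : AEMeasurable X P
  integrable : Integrable (fun ω => (X ω : ℝ)) P
  identity : ∀ x : ℕ,
    ∑ j ∈ Finset.range (x + 1), ((∫ ω, (X ω : ℝ) ∂P) - j) * P.real {ω | X ω = j} =
      quad δ β γ x * P.real {ω | X ω = x}

end Pearson

/-!
Let `q = quad δ β γ`. The Pearson identity says that `q` is the Stein kernel of `X`, that is,
`E[(X - m) g(X)] = E[q(X) g'(X)]` (with `Δg` for `g'` in the discrete case). Applied to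
`u q^j g^(j)` for a polynomial `u`, it moves a polynomial weight from `q^(j+1) g^(j+1)` to
`q^j g^(j)` at the cost of one degree. Descending from the weight `1` at level `k` yields the
Rodrigues polynomial `φₖ`, with `E[φₖ(X) g(X)] = E[q^k(X) g^(k)(X)]` and leading coefficient
`∏ (1 - j δ)`, `k - 1 ≤ j ≤ 2 k - 2`. Taking polynomials for `g` shows that the `φₖ` are
orthogonal in `L²(X)`, with `E[φₖ²] = k! E[q^k] ∏ (1 - j δ)`; since the moment generating function
is finite near zero, polynomials are dense there, and the series is Parseval's identity.

The descent needs all polynomial weights to be integrable against `q^j g^(j)`. For `δ ≠ 0` this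
holds because `X` is bounded: if `δ < 0`, since `q(X) ≥ 0`, and if `δ > 0`, since a leading
coefficient `∏ (1 - j δ)` would otherwise be negative although `E[φₖ X^k] > 0`. For `δ = 0` the
operators involved do not raise degrees, and integrability follows by induction on the degree.
-/

namespace Pearson

open Polynomial Filter Topology

section TopCoeff

variable {R : Type*} [CommRing R] {p q : R[X]} {a b c : R} {d n : ℕ}

/-- `p = c X ^ d + (terms of lower degree)`. The coefficient `c` may vanish, so that sums and
products need no case distinction. -/
def HasTopCoeff (p : R[X]) (d : ℕ) (c : R) : Prop :=
  p.natDegree ≤ d ∧ p.coeff d = c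

namespace HasTopCoeff

theorem of_natDegree_le (h : p.natDegree ≤ d) : HasTopCoeff p d (p.coeff d) :=
  ⟨h, rfl⟩

theorem natDegree_le_of_zero (hp : HasTopCoeff p (d + 1) 0) : p.natDegree ≤ d := by
  refine natDegree_le_iff_coeff_eq_zero.2 fun n hn => ?_
  rcases (Nat.succ_le_of_lt hn).eq_or_lt with rfl | hlt
  · exact hp.2
  · exact coeff_eq_zero_of_natDegree_lt (hp.1.trans_lt hlt)

theorem sub (hp : HasTopCoeff p d a) (hq : HasTopCoeff q d b) : HasTopCoeff (p - q) d (a - b) :=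
  ⟨natDegree_sub_le_of_le hp.1 hq.1 |>.trans_eq (max_self d), by rw [coeff_sub, hp.2, hq.2]⟩

theorem add (hp : HasTopCoeff p d a) (hq : HasTopCoeff q d b) : HasTopCoeff (p + q) d (a + b) :=
  ⟨natDegree_add_le_of_degree_le hp.1 hq.1, by rw [coeff_add, hp.2, hq.2]⟩

theorem mul (hp : HasTopCoeff p d a) (hq : HasTopCoeff q n b) :
    HasTopCoeff (p * q) (d + n) (a * b) :=
  ⟨natDegree_mul_le_of_le hp.1 hq.1, by
    rw [coeff_mul_add_eq_of_natDegree_le hp.1 hq.1, hp.2, hq.2]⟩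

theorem taylor (hp : HasTopCoeff p d c) (r : R) : HasTopCoeff (taylor r p) d c := by
  refine ⟨(natDegree_taylor p r).trans_le hp.1, ?_⟩
  rw [taylor_coeff, eval_eq_sum_range' (n := 1)]
  · simp [hasseDeriv_coeff, hp.2]
  · have := natDegree_hasseDeriv_le p d
    have := hp.1
    omega

theorem derivative (hp : HasTopCoeff p d c) : HasTopCoeff (derivative p) (d - 1) (d * c) := by
  refine ⟨(natDegree_derivative_le p).trans (Nat.sub_le_sub_right hp.1 1), ?_⟩
  rcases d with _ | d
  · rw [derivative_of_natDegree_zero (Nat.le_zero.1 hp.1)]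
    simp
  · rw [coeff_derivative, Nat.add_sub_cancel, hp.2]
    push_cast
    ring

theorem taylor_sub (hp : HasTopCoeff p d c) (r : R) :
    HasTopCoeff (Polynomial.taylor r p - p) (d - 1) (r * (d * c)) := by
  refine ⟨natDegree_le_iff_coeff_eq_zero.2 fun n hn => ?_, ?_⟩
  · have hn' : HasTopCoeff p n (p.coeff n) := of_natDegree_le (hp.1.trans (by omega))
    rw [coeff_sub, (hn'.taylor r).2, sub_self]
  · rcases d with _ | d
    · rw [coeff_sub, (hp.taylor r).2, hp.2]
      simp
    · rw [coeff_sub, Nat.add_sub_cancel, taylor_coeff, eval_eq_sum_range' (n := 2)]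
      · simp only [hasseDeriv_coeff, Finset.sum_range_succ, Finset.range_one, Finset.sum_singleton,
          zero_add, Nat.choose_self, Nat.cast_one, one_mul, pow_zero, mul_one, add_comm 1 d,
          Nat.choose_succ_self_right, Nat.cast_add, hp.2, pow_one, add_sub_cancel_left]
        ring
      · have := natDegree_hasseDeriv_le p d
        have := hp.1
        omega

/-- At `d = 0` the factor `d` forces `q = 0`, so that the truncated `d - 1` does no harm. -/
theorem quadratic_mul (hp : HasTopCoeff p 2 a) (hq : HasTopCoeff q (d - 1) (d * c)) :
    HasTopCoeff (p * q) (d + 1) (a * (d * c)) := by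
  rcases d with _ | d
  · obtain rfl : q = 0 := by
      rw [eq_C_of_natDegree_le_zero hq.1, hq.2]
      simp
    simp [HasTopCoeff]
  · simpa [add_comm, add_left_comm] using hp.mul hq

theorem iterate_eq_C {T : R[X] → R[X]}
    (hT : ∀ (p : R[X]) (d : ℕ) (c : R), HasTopCoeff p d c → HasTopCoeff (T p) (d - 1) (d * c))
    (k : ℕ) (hp : HasTopCoeff p k c) : T^[k] p = C (k.factorial * c) := by
  induction k generalizing p c with
  | zero => simpa [hp.2] using eq_C_of_natDegree_le_zero hp.1
  | succ k ih =>
    rw [Function.iterate_succ_apply, ih (hT p _ c hp), Nat.factorial_succ]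
    push_cast
    ring_nf

end HasTopCoeff

end TopCoeff

section Moments

variable {Ω : Type*} [MeasurableSpace Ω] {P : Measure Ω} {Y : Ω → ℝ}

theorem FiniteMGFNearZero.zero_mem_interior (h : FiniteMGFNearZero Y P) :
    0 ∈ interior (integrableExpSet Y P) := by
  obtain ⟨t, ht, hI⟩ := h
  exact mem_interior.2 ⟨Set.Ioo (-t) t, hI, isOpen_Ioo, by simpa using ht⟩

theorem integrable_eval (h : 0 ∈ interior (integrableExpSet Y P)) (p : ℝ[X]) :
    Integrable (fun ω => p.eval (Y ω)) P := by
  simp only [eval_eq_sum_range]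
  exact integrable_finsetSum _ fun n _ =>
    (integrable_pow_of_mem_interior_integrableExpSet h n).const_mul _

theorem memLp_two_eval (h : 0 ∈ interior (integrableExpSet Y P)) (p : ℝ[X]) :
    MemLp (fun ω => p.eval (Y ω)) 2 P := by
  rw [memLp_two_iff_integrable_sq (integrable_eval h p).aestronglyMeasurable]
  refine (integrable_eval h (p ^ 2)).congr (ae_of_all _ fun ω => eval_pow 2)

theorem zero_mem_interior_integrableExpSet_map_iff (hY : AEMeasurable Y P) :
    0 ∈ interior (integrableExpSet id (P.map Y)) ↔ 0 ∈ interior (integrableExpSet Y P) := by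
  have : integrableExpSet id (P.map Y) = integrableExpSet Y P := by
    ext t
    exact integrable_map_measure (by fun_prop) hY
  rw [this]

section Determinacy

variable {μ ν : Measure ℝ}

theorem complexMGF_eventuallyEq_of_moments
    (hμ : 0 ∈ interior (integrableExpSet id μ)) (hν : 0 ∈ interior (integrableExpSet id ν))
    (h : ∀ n : ℕ, ∫ x, x ^ n ∂μ = ∫ x, x ^ n ∂ν) :
    complexMGF id μ =ᶠ[𝓝 0] complexMGF id ν := by
  have hderiv : ∀ n, iteratedDeriv n (complexMGF id μ) 0 = iteratedDeriv n (complexMGF id ν) 0 := by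
    intro n
    rw [iteratedDeriv_complexMGF (by simpa using hμ), iteratedDeriv_complexMGF (by simpa using hν)]
    simpa [← Complex.ofReal_pow, integral_complex_ofReal] using h n
  have hsμ := (analyticAt_complexMGF (X := id) (μ := μ) (z := 0) (by simpa)).hasFPowerSeriesAt
  have hsν := (analyticAt_complexMGF (X := id) (μ := ν) (z := 0) (by simpa)).hasFPowerSeriesAt
  simp only [hderiv] at hsμ
  have hsub := hsμ.sub hsν
  rw [sub_self] at hsub
  exact hsub.eventually_eq_zero.mono fun z hz => sub_eq_zero.1 hz

theorem ext_of_moments [IsFiniteMeasure μ] [IsFiniteMeasure ν]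
    (hμ : 0 ∈ interior (integrableExpSet id μ)) (hν : 0 ∈ interior (integrableExpSet id ν))
    (h : ∀ n : ℕ, ∫ x, x ^ n ∂μ = ∫ x, x ^ n ∂ν) : μ = ν := by
  let strip : Set ℂ := {z | z.re ∈ interior (integrableExpSet id μ)} ∩
    {z | z.re ∈ interior (integrableExpSet id ν)}
  have hstrip : IsPreconnected strip :=
    ((convex_integrableExpSet.interior.linear_preimage Complex.reLm).inter
      (convex_integrableExpSet.interior.linear_preimage Complex.reLm)).isPreconnected
  have heq : Set.EqOn (complexMGF id μ) (complexMGF id ν) strip :=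
    AnalyticOnNhd.eqOn_of_preconnected_of_eventuallyEq
      (analyticOnNhd_complexMGF.mono Set.inter_subset_left)
      (analyticOnNhd_complexMGF.mono Set.inter_subset_right) hstrip
      (z₀ := 0) ⟨by simpa using hμ, by simpa using hν⟩ (complexMGF_eventuallyEq_of_moments hμ hν h)
  refine Measure.ext_of_charFun (funext fun t => ?_)
  rw [← complexMGF_id_mul_I, ← complexMGF_id_mul_I]
  exact heq ⟨by simpa using hμ, by simpa using hν⟩

end Determinacy

theorem integrable_withDensity_ofReal_iff {α : Type*} [MeasurableSpace α] {μ : Measure α}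
    {f : α → ℝ} (hf : AEMeasurable f μ) {g : α → ℝ} :
    Integrable g (μ.withDensity fun x => ENNReal.ofReal (f x)) ↔
      Integrable (fun x => max (f x) 0 * g x) μ := by
  simp [integrable_withDensity_iff_integrable_smul₀' hf.ennreal_ofReal,
    ENNReal.toReal_ofReal']

theorem integral_withDensity_ofReal {α : Type*} [MeasurableSpace α] {μ : Measure α}
    {f : α → ℝ} (hf : AEMeasurable f μ) (g : α → ℝ) :
    ∫ x, g x ∂(μ.withDensity fun x => ENNReal.ofReal (f x)) = ∫ x, max (f x) 0 * g x ∂μ := by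
  simp [integral_withDensity_eq_integral_toReal_smul₀ hf.ennreal_ofReal,
    ENNReal.toReal_ofReal']

variable {μ : Measure ℝ}

theorem zero_mem_interior_integrableExpSet_withDensity
    (hμ : 0 ∈ interior (integrableExpSet id μ)) {g : ℝ → ℝ} (hg : MemLp g 2 μ) :
    0 ∈ interior (integrableExpSet id (μ.withDensity fun x => ENNReal.ofReal (g x))) := by
  have hdouble : Tendsto (fun t : ℝ => 2 * t) (𝓝 0) (𝓝 0) := by
    simpa using (continuous_const_mul (2 : ℝ)).tendsto 0
  rw [mem_interior_iff_mem_nhds] at hμ ⊢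
  filter_upwards [hdouble hμ] with t ht
  have hexp : MemLp (fun x : ℝ => Real.exp (t * x)) 2 μ := by
    rw [memLp_two_iff_integrable_sq (by fun_prop)]
    refine Integrable.congr (show Integrable (fun x => Real.exp (2 * t * x)) μ from ht)
      (ae_of_all _ fun x => ?_)
    simp only [sq, ← Real.exp_add]
    ring_nf
  exact (integrable_withDensity_ofReal_iff hg.1.aemeasurable).2 (hg.pos_part.integrable_mul hexp)

theorem ae_eq_zero_of_forall_integral_eval_mul [IsFiniteMeasure μ]
    (hμ : 0 ∈ interior (integrableExpSet id μ)) {g : ℝ → ℝ} (hg : MemLp g 2 μ)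
    (h : ∀ p : ℝ[X], ∫ x, p.eval x * g x ∂μ = 0) : g =ᵐ[μ] 0 := by
  have hneg : MemLp (fun x => -g x) 2 μ := hg.neg
  have hm : AEMeasurable g μ := hg.1.aemeasurable
  have hm' : AEMeasurable (fun x => -g x) μ := hm.neg
  have hint : Integrable g μ := hg.integrable one_le_two
  have := isFiniteMeasure_withDensity_ofReal hint.2
  have := isFiniteMeasure_withDensity_ofReal hint.fun_neg.2
  have hsplit : ∀ x, max (g x) 0 - max (-g x) 0 = g x := fun x =>
    max_zero_sub_max_neg_zero_eq_self (g x)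
  have hparts : (μ.withDensity fun x => ENNReal.ofReal (g x)) =
      μ.withDensity fun x => ENNReal.ofReal (-g x) := by
    refine ext_of_moments (zero_mem_interior_integrableExpSet_withDensity hμ hg)
      (zero_mem_interior_integrableExpSet_withDensity hμ hneg) fun n => ?_
    have hpow : MemLp (fun x : ℝ => x ^ n) 2 μ := by simpa using memLp_two_eval hμ (X ^ n)
    have hpos : Integrable (fun x => max (g x) 0 * x ^ n) μ := hg.pos_part.integrable_mul hpow
    have hneg : Integrable (fun x => max (-g x) 0 * x ^ n) μ := hneg.pos_part.integrable_mul hpow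
    rw [integral_withDensity_ofReal hm, integral_withDensity_ofReal hm', ← sub_eq_zero,
      ← integral_sub hpos hneg]
    simp only [← sub_mul, hsplit]
    simpa [mul_comm] using h (X ^ n)
  rw [withDensity_eq_iff hm.ennreal_ofReal hm'.ennreal_ofReal
    hint.lintegral_lt_top.ne] at hparts
  filter_upwards [hparts] with x hx
  have hmax : max (g x) 0 = max (-g x) 0 := by
    simpa only [ENNReal.toReal_ofReal'] using congrArg ENNReal.toReal hx
  simpa [hmax] using (hsplit x).symm

end Moments

theorem hasSum_inner_mul_inner_div_norm_sq {ι E : Type*} [NormedAddCommGroup E]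
    [InnerProductSpace ℝ E] [CompleteSpace E] {φ : ι → E}
    (horth : Pairwise fun i j => inner ℝ (φ i) (φ j) = 0)
    (hcomplete : ∀ w, (∀ i, inner ℝ (φ i) w = 0) → w = 0) (x y : E) :
    HasSum (fun i => inner ℝ (φ i) x * inner ℝ (φ i) y / ‖φ i‖ ^ 2) (inner ℝ x y) := by
  let v : {i // φ i ≠ 0} → E := fun i => (‖φ i‖⁻¹ : ℝ) • φ i
  have hv : Orthonormal ℝ v := by
    refine ⟨fun i => ?_, fun i j hij => ?_⟩
    · rw [norm_smul, norm_inv, norm_norm, inv_mul_cancel₀ (norm_ne_zero_iff.2 i.2)]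
    · simp [v, inner_smul_left, inner_smul_right, horth (Subtype.coe_injective.ne hij)]
  have hbot : (Submodule.span ℝ (Set.range v))ᗮ = ⊥ := by
    refine (Submodule.eq_bot_iff _).2 fun w hw => hcomplete w fun i => ?_
    by_cases hi : φ i = 0
    · rw [hi, inner_zero_left]
    · simpa [v, inner_smul_left, hi] using
        (Submodule.mem_orthogonal _ _).1 hw (v ⟨i, hi⟩) (Submodule.subset_span ⟨_, rfl⟩)
  let b := HilbertBasis.mkOfOrthogonalEqBot hv hbot
  have hb : ⇑b = v := HilbertBasis.coe_mkOfOrthogonalEqBot hv hbot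
  refine (hasSum_subtype_iff_of_support_subset (s := {i | φ i ≠ 0}) fun i hi hi0 => ?_).1
    ((b.hasSum_inner_mul_inner x y).congr_fun fun i => ?_)
  · simp_all
  · simp only [hb, v, Function.comp, inner_smul_left, inner_smul_right, conj_trivial,
      real_inner_comm x]
    ring

/-- The polynomials `p k` are orthogonal in `L²(μ)`: each `p k` has degree at most `k`, is
orthogonal to all polynomials of lower degree, and pairs with `X ^ k` to `e k`. The numbers `e k`
may vanish, so that measures with finite support are included. -/
structure IsOrthogonalSystem (μ : Measure ℝ) (p : ℕ → ℝ[X]) (e : ℕ → ℝ) : Prop where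
  natDegree_le : ∀ k, (p k).natDegree ≤ k
  nonneg : ∀ k, 0 ≤ e k
  integral_mul : ∀ (k : ℕ) (u : ℝ[X]), u.natDegree ≤ k →
    ∫ x, (p k).eval x * u.eval x ∂μ = e k * u.coeff k

namespace IsOrthogonalSystem

variable {μ : Measure ℝ} {p : ℕ → ℝ[X]} {e : ℕ → ℝ}

theorem integral_mul_self (h : IsOrthogonalSystem μ p e) (k : ℕ) :
    ∫ x, (p k).eval x * (p k).eval x ∂μ = e k * (p k).coeff k :=
  h.integral_mul k _ (h.natDegree_le k)

theorem integral_mul_eq_zero (h : IsOrthogonalSystem μ p e) {k : ℕ} {u : ℝ[X]}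
    (hu : u.natDegree < k) : ∫ x, (p k).eval x * u.eval x ∂μ = 0 := by
  rw [h.integral_mul k u hu.le, coeff_eq_zero_of_natDegree_lt hu, mul_zero]

theorem pairwise_integral_mul_eq_zero (h : IsOrthogonalSystem μ p e) :
    Pairwise fun k l => ∫ x, (p k).eval x * (p l).eval x ∂μ = 0 := by
  intro k l hkl
  rcases hkl.lt_or_gt with hlt | hlt
  · simpa only [mul_comm] using h.integral_mul_eq_zero ((h.natDegree_le k).trans_lt hlt)
  · exact h.integral_mul_eq_zero ((h.natDegree_le l).trans_lt hlt)

variable (hμ : 0 ∈ interior (integrableExpSet id μ))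
include hμ

theorem coeff_pos (h : IsOrthogonalSystem μ p e) {k : ℕ} (hk : 0 < e k) :
    0 < (p k).coeff k := by
  have hsq : Integrable (fun x => (p k).eval x * (p k).eval x) μ := by
    simpa using integrable_eval hμ (p k * p k)
  have hnonneg : 0 ≤ e k * (p k).coeff k := by
    rw [← h.integral_mul_self]
    exact integral_nonneg fun x => mul_self_nonneg _
  refine (nonneg_of_mul_nonneg_right hnonneg hk).lt_of_ne' fun hzero => hk.ne' ?_
  have hnull : ∀ᵐ x ∂μ, (p k).eval x = 0 := by
    have := (integral_eq_zero_iff_of_nonneg (fun x => mul_self_nonneg _) hsq).1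
      (by rw [h.integral_mul_self, hzero, mul_zero])
    exact this.mono fun x hx => mul_self_eq_zero.1 hx
  have hpair := h.integral_mul k (X ^ k) (natDegree_X_pow k).le
  rwa [integral_eq_zero_of_ae (hnull.mono fun x hx => by simp [hx]), coeff_X_pow_self, mul_one,
    eq_comm] at hpair

variable (hsupp : ∀ k, e k = 0 → ∃ s : Finset ℝ, s.card = k ∧ ∀ᵐ x ∂μ, x ∈ s)
include hsupp

/-- Where `e k = 0`, the polynomial `p k` vanishes almost everywhere and is of no use; it is
replaced by the nodal polynomial of the support. -/
theorem exists_degree_eq (h : IsOrthogonalSystem μ p e) {g : ℝ → ℝ}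
    (hg : ∀ k, ∫ x, (p k).eval x * g x ∂μ = 0) (k : ℕ) :
    ∃ q : ℝ[X], q.degree = k ∧ ∫ x, q.eval x * g x ∂μ = 0 := by
  rcases (h.nonneg k).eq_or_lt' with hk | hk
  · obtain ⟨s, hs, hmem⟩ := hsupp k hk
    refine ⟨Lagrange.nodal s id, by rw [Lagrange.degree_nodal, hs],
      integral_eq_zero_of_ae (hmem.mono fun x hx => ?_)⟩
    have hx0 : (Lagrange.nodal s id).eval x = 0 := Lagrange.eval_nodal_at_node (v := id) hx
    simp [hx0]
  · exact ⟨p k, degree_eq_of_le_of_coeff_ne_zero (natDegree_le_iff_degree_le.1 (h.natDegree_le k))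
      (h.coeff_pos hμ hk).ne', hg k⟩

theorem ae_eq_zero_of_forall_integral_mul [IsFiniteMeasure μ] (h : IsOrthogonalSystem μ p e)
    {g : ℝ → ℝ} (hg : MemLp g 2 μ) (hzero : ∀ k, ∫ x, (p k).eval x * g x ∂μ = 0) : g =ᵐ[μ] 0 := by
  choose q hdeg hq using h.exists_degree_eq hμ hsupp hzero
  let S : Polynomial.Sequence ℝ := ⟨q, hdeg⟩
  have hspan : Submodule.span ℝ (Set.range S) = ⊤ :=
    S.span fun k => (leadingCoeff_ne_zero.2 (S.ne_zero k)).isUnit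
  have hint : ∀ u : ℝ[X], Integrable (fun x => u.eval x * g x) μ := fun u =>
    (memLp_two_eval hμ u).integrable_mul hg
  refine ae_eq_zero_of_forall_integral_eval_mul hμ hg fun u => ?_
  induction (hspan ▸ Submodule.mem_top : u ∈ Submodule.span ℝ (Set.range S))
    using Submodule.span_induction with
  | mem _ hu => obtain ⟨k, rfl⟩ := hu; exact hq k
  | zero => simp
  | add u v _ _ hu hv =>
    simp only [eval_add, add_mul]
    rw [integral_add (hint u) (hint v), hu, hv, add_zero]
  | smul a u _ hu => simp only [eval_smul, smul_eq_mul, mul_assoc, integral_const_mul, hu, mul_zero]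

theorem hasSum_integral_mul [IsFiniteMeasure μ] (h : IsOrthogonalSystem μ p e)
    {g₁ g₂ : ℝ → ℝ} (hg₁ : MemLp g₁ 2 μ) (hg₂ : MemLp g₂ 2 μ) :
    HasSum (fun k => (∫ x, (p k).eval x * g₁ x ∂μ) * (∫ x, (p k).eval x * g₂ x ∂μ) /
      (e k * (p k).coeff k)) (∫ x, g₁ x * g₂ x ∂μ) := by
  have hp : ∀ k, MemLp (fun x => (p k).eval x) 2 μ := fun k => memLp_two_eval hμ (p k)
  let φ : ℕ → Lp ℝ 2 μ := fun k => (hp k).toLp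
  have hinner : ∀ {f g : ℝ → ℝ} (hf : MemLp f 2 μ) (hg : MemLp g 2 μ),
      inner ℝ hf.toLp hg.toLp = ∫ x, f x * g x ∂μ := fun hf hg => by
    rw [L2.inner_def]
    refine integral_congr_ae ?_
    filter_upwards [hf.coeFn_toLp, hg.coeFn_toLp] with x hfx hgx
    simp [hfx, hgx, mul_comm]
  have hnorm : ∀ k, ‖φ k‖ ^ 2 = e k * (p k).coeff k := fun k => by
    rw [← real_inner_self_eq_norm_sq, hinner, h.integral_mul_self]
  have hsum := hasSum_inner_mul_inner_div_norm_sq (φ := φ)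
    (fun k l hkl => (hinner _ _).trans (h.pairwise_integral_mul_eq_zero hkl))
    (fun w hw => Lp.eq_zero_iff_ae_eq_zero.2 <|
      h.ae_eq_zero_of_forall_integral_mul hμ hsupp (Lp.memLp w) fun k => by
        rw [← hinner (hp k) (Lp.memLp w), Lp.toLp_coeFn, hw k])
    hg₁.toLp hg₂.toLp
  simpa only [φ, hinner, hnorm] using hsum

theorem hasSum_covariance [IsProbabilityMeasure μ] (h : IsOrthogonalSystem μ p e)
    (hone : p 0 = 1) {g₁ g₂ : ℝ → ℝ} (hg₁ : MemLp g₁ 2 μ) (hg₂ : MemLp g₂ 2 μ) :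
    HasSum (fun n => (∫ x, (p (n + 1)).eval x * g₁ x ∂μ) * (∫ x, (p (n + 1)).eval x * g₂ x ∂μ) /
      (e (n + 1) * (p (n + 1)).coeff (n + 1))) (cov[g₁, g₂; μ]) := by
  have hnorm : e 0 * (p 0).coeff 0 = 1 := by
    rw [← h.integral_mul_self, hone]
    simp
  have hsum := (hasSum_nat_add_iff' 1).2 (h.hasSum_integral_mul hμ hsupp hg₁ hg₂)
  rw [Finset.sum_range_one, hnorm] at hsum
  simpa [hone, covariance_eq_sub hg₁ hg₂] using hsum

end IsOrthogonalSystem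

section Rodrigues

variable {t m δ : ℝ} {B : ℕ → ℝ[X] → ℝ[X]}

/-- The operators `B j` raise degrees by at most one, and act on top coefficients as
`u ↦ q u' + j q' u` does for a quadratic `q` with leading coefficient `δ`. -/
def IsRaising (δ : ℝ) (B : ℕ → ℝ[X] → ℝ[X]) : Prop :=
  ∀ (j d : ℕ) (u : ℝ[X]) (c : ℝ), HasTopCoeff u d c →
    HasTopCoeff (B j u) (d + 1) ((2 * j + d) * δ * c)

/-- The operator that moves a weight from the `(j + 1)`-st to the `j`-th function of a Stein
chain, see `IsSteinChain`. -/
noncomputable def steinAdjoint (t m : ℝ) (B : ℕ → ℝ[X] → ℝ[X]) (j : ℕ) (v : ℝ[X]) : ℝ[X] :=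
  (X - C m) * taylor (-t) v - B j (taylor (-t) v)

/-- The operators `steinAdjoint t m B j` for `j = k - 1, …, 1, 0`, applied to `v` in this order.
For `v = 1` these are the polynomials of the Rodrigues formula. -/
noncomputable def rodrigues (t m : ℝ) (B : ℕ → ℝ[X] → ℝ[X]) : ℕ → ℝ[X] → ℝ[X]
  | 0, v => v
  | k + 1, v => rodrigues t m B k (steinAdjoint t m B k v)

/-- The leading coefficient of the `k`-th Rodrigues polynomial. -/
noncomputable def rodriguesCoeff (δ : ℝ) (k : ℕ) : ℝ :=
  ∏ j ∈ Finset.range k, (1 - ((j : ℝ) + k - 1) * δ)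

theorem rodriguesCoeff_succ (δ : ℝ) (n : ℕ) :
    rodriguesCoeff δ (n + 1) = ∏ j ∈ Finset.Icc n (2 * n), (1 - (j : ℝ) * δ) := by
  rw [rodriguesCoeff, ← Finset.Ico_add_one_right_eq_Icc, Finset.prod_Ico_eq_prod_range,
    show 2 * n + 1 - n = n + 1 by omega]
  refine Finset.prod_congr rfl fun j _ => ?_
  push_cast
  ring

theorem nonpos_of_rodriguesCoeff_pos (h : ∀ k, 0 < rodriguesCoeff δ k) : δ ≤ 0 := by
  by_contra! hδ
  obtain ⟨N, hN⟩ := exists_nat_gt (1 / δ)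
  have hN' : 1 < N * δ := by rwa [div_lt_iff₀ hδ] at hN
  -- an odd number of factors, all of them negative
  have hfactor : ∀ j ∈ Finset.range (2 * N + 1),
      0 < -(1 - ((j : ℝ) + (2 * N + 1 : ℕ) - 1) * δ) := by
    intro j _
    have : 0 ≤ (j + N : ℝ) * δ := by positivity
    push_cast
    linarith
  have hneg := Finset.prod_pos hfactor
  rw [Finset.prod_neg, Finset.card_range, Odd.neg_one_pow ⟨N, rfl⟩, neg_one_mul] at hneg
  exact (h (2 * N + 1)).not_gt (neg_pos.1 hneg)

theorem IsRaising.hasTopCoeff_steinAdjoint (hB : IsRaising δ B) {v : ℝ[X]} {d : ℕ} {c : ℝ}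
    (hv : HasTopCoeff v d c) (j : ℕ) :
    HasTopCoeff (steinAdjoint t m B j v) (d + 1) ((1 - (2 * j + d) * δ) * c) := by
  have hX : HasTopCoeff (X - C m) 1 1 := ⟨(natDegree_X_sub_C m).le, by simp⟩
  have hshift := hv.taylor (-t)
  have hprod := hX.mul hshift
  rw [add_comm 1 d] at hprod
  rw [show (1 - (2 * j + d) * δ) * c = 1 * c - (2 * j + d) * δ * c by ring]
  exact hprod.sub (hB j d _ c hshift)

theorem IsRaising.hasTopCoeff_rodrigues (hB : IsRaising δ B) (k : ℕ) {v : ℝ[X]} {d : ℕ} {c : ℝ}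
    (hv : HasTopCoeff v d c) :
    HasTopCoeff (rodrigues t m B k v) (d + k)
      ((∏ j ∈ Finset.range k, (1 - ((j : ℝ) + d + k - 1) * δ)) * c) := by
  induction k generalizing v d c with
  | zero => simpa [rodrigues] using hv
  | succ k ih =>
    have hprod : ∀ j ∈ Finset.range k, 1 - ((j : ℝ) + (d + 1 : ℕ) + k - 1) * δ =
        1 - ((j : ℝ) + d + (k + 1 : ℕ) - 1) * δ := fun j _ => by
      push_cast
      ring
    have hcoeff := ih (hB.hasTopCoeff_steinAdjoint (t := t) (m := m) hv k)
    rw [add_right_comm, ← mul_assoc, Finset.prod_congr rfl hprod] at hcoeff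
    rw [Finset.prod_range_succ, show 1 - ((k : ℝ) + d + (k + 1 : ℕ) - 1) * δ =
      1 - (2 * k + d) * δ by push_cast; ring]
    exact hcoeff

theorem IsRaising.hasTopCoeff_rodrigues_one (hB : IsRaising δ B) (k : ℕ) :
    HasTopCoeff (rodrigues t m B k 1) k (rodriguesCoeff δ k) := by
  have hone : HasTopCoeff (1 : ℝ[X]) 0 1 := by simp [HasTopCoeff]
  simpa [rodriguesCoeff] using hB.hasTopCoeff_rodrigues k hone

end Rodrigues

section Chain

variable {Ω : Type*} [MeasurableSpace Ω] {P : Measure Ω} {Y : Ω → ℝ} {t m : ℝ}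
  {B : ℕ → ℝ[X] → ℝ[X]} {G : ℕ → Ω → ℝ}

/-- The functions `G 0, G 1, …` are linked by the covariance identities
`E[(Y - m) u(Y) Gⱼ] = E[u(Y + t) Gⱼ₊₁ + (Bⱼ u)(Y) Gⱼ]` for polynomials `u`. In the applications
`Gⱼ = q^j(Y) g^(j)(Y)` with `t = 0` and `Gⱼ = q^[j](Y) Δ^j g(Y)` with `t = 1`. -/
def IsSteinChain (P : Measure Ω) (Y : Ω → ℝ) (t m : ℝ) (B : ℕ → ℝ[X] → ℝ[X])
    (G : ℕ → Ω → ℝ) : Prop :=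
  ∀ (j : ℕ) (u : ℝ[X]),
    Integrable (fun ω => (taylor t u).eval (Y ω) * G (j + 1) ω + (B j u).eval (Y ω) * G j ω) P →
    Integrable (fun ω => (Y ω - m) * (u.eval (Y ω) * G j ω)) P ∧
      ∫ ω, (Y ω - m) * (u.eval (Y ω) * G j ω) ∂P =
        ∫ ω, ((taylor t u).eval (Y ω) * G (j + 1) ω + (B j u).eval (Y ω) * G j ω) ∂P

namespace IsSteinChain

theorem integral_eval_mul_succ (h : IsSteinChain P Y t m B G)
    (hG : ∀ (j : ℕ) (u : ℝ[X]), Integrable (fun ω => u.eval (Y ω) * G j ω) P) (j : ℕ)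
    (v : ℝ[X]) : ∫ ω, v.eval (Y ω) * G (j + 1) ω ∂P =
      ∫ ω, (steinAdjoint t m B j v).eval (Y ω) * G j ω ∂P := by
  obtain ⟨hint, hstein⟩ := h j (taylor (-t) v) ((hG _ _).add (hG _ _))
  rw [integral_add (hG _ _) (hG _ _), taylor_taylor, add_neg_cancel, taylor_zero] at hstein
  rw [eq_sub_of_add_eq hstein.symm, ← integral_sub hint (hG _ _)]
  simp only [steinAdjoint, eval_sub, eval_mul, eval_X, eval_C, sub_mul, mul_assoc]

theorem integral_rodrigues (h : IsSteinChain P Y t m B G)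
    (hG : ∀ (j : ℕ) (u : ℝ[X]), Integrable (fun ω => u.eval (Y ω) * G j ω) P) (k : ℕ)
    (v : ℝ[X]) : ∫ ω, (rodrigues t m B k v).eval (Y ω) * G 0 ω ∂P =
      ∫ ω, v.eval (Y ω) * G k ω ∂P := by
  induction k generalizing v with
  | zero => rfl
  | succ k ih => rw [rodrigues, ih, h.integral_eval_mul_succ hG]

theorem integrable_eval_mul_of_isRaising (h : IsSteinChain P Y t m B G) (hB : IsRaising 0 B)
    (hG : ∀ j, Integrable (G j) P) (j : ℕ) (u : ℝ[X]) :
    Integrable (fun ω => u.eval (Y ω) * G j ω) P := by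
  suffices ∀ (n j : ℕ) (u : ℝ[X]), u.natDegree ≤ n →
      Integrable (fun ω => u.eval (Y ω) * G j ω) P from this _ j u le_rfl
  intro n
  induction n with
  | zero =>
    intro j u hu
    rw [eq_C_of_natDegree_le_zero hu]
    simpa using (hG j).const_mul _
  | succ n ih =>
    intro j u hu
    let v := u /ₘ (X - C m)
    have hv : v.natDegree ≤ n := by
      rw [natDegree_divByMonic _ (monic_X_sub_C m), natDegree_X_sub_C]
      omega
    have hBv : (B j v).natDegree ≤ n := by
      have := hB j n v _ (.of_natDegree_le hv)
      rw [mul_zero, zero_mul] at this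
      exact this.natDegree_le_of_zero
    obtain ⟨hint, -⟩ := h j v ((ih _ _ ((natDegree_taylor _ _).trans_le hv)).add (ih _ _ hBv))
    refine (hint.add ((hG j).const_mul (u.eval m))).congr (ae_of_all _ fun ω => ?_)
    have hdiv : u.eval m + (Y ω - m) * v.eval (Y ω) = u.eval (Y ω) := by
      have := congrArg (eval (Y ω)) (modByMonic_add_div u (X - C m))
      simpa only [modByMonic_X_sub_C_eq_C_eval, eval_add, eval_mul, eval_sub, eval_X, eval_C]
    simp only [Pi.add_apply]
    rw [← hdiv]
    ring

end IsSteinChain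

theorem integrable_eval_mul_of_ae_le (hY : AEMeasurable Y P) {R : ℝ}
    (hR : ∀ᵐ ω ∂P, |Y ω| ≤ R) {f : Ω → ℝ} (hf : Integrable f P) (u : ℝ[X]) :
    Integrable (fun ω => u.eval (Y ω) * f ω) P := by
  obtain ⟨M, hM⟩ := (isCompact_Icc (a := -R) (b := R)).exists_bound_of_continuousOn
    (f := fun x => u.eval x) (by fun_prop)
  refine hf.bdd_mul (u.continuous.measurable.comp_aemeasurable hY).aestronglyMeasurable
    (hR.mono fun ω hω => hM _ (abs_le.1 hω))

end Chain

/-- The data common to the continuous and the discrete Pearson families: the random variable `Y`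
has chains of covariance identities with respect to `B`, in particular one starting from each
polynomial `u`, whose `k`-th expectation is that of a `k`-th derivative (or difference) times
`q^k` (or `q^[k]`), of mean `e k`. The last two fields describe the support in the exceptional
cases. -/
structure IsPearsonSystem {Ω : Type*} [MeasurableSpace Ω] (P : Measure Ω) (Y : Ω → ℝ)
    (t m δ : ℝ) (B : ℕ → ℝ[X] → ℝ[X]) (e : ℕ → ℝ) : Prop where
  mgf : 0 ∈ interior (integrableExpSet Y P)
  isRaising : IsRaising δ B
  exists_chain : ∀ u : ℝ[X], ∃ G : ℕ → ℝ[X], G 0 = u ∧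
    IsSteinChain P Y t m B (fun j ω => (G j).eval (Y ω)) ∧
    ∀ k, u.natDegree ≤ k → ∫ ω, (G k).eval (Y ω) ∂P = k.factorial * u.coeff k * e k
  nonneg : ∀ k, 0 ≤ e k
  finite_support : ∀ k, e k = 0 → ∃ s : Finset ℝ, s.card = k ∧ ∀ᵐ ω ∂P, Y ω ∈ s
  bounded_of_neg : δ < 0 → ∃ R, ∀ᵐ ω ∂P, |Y ω| ≤ R

namespace IsPearsonSystem

variable {Ω : Type*} [MeasurableSpace Ω] {P : Measure Ω} {Y : Ω → ℝ} {t m δ : ℝ}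
  {B : ℕ → ℝ[X] → ℝ[X]} {e : ℕ → ℝ}

theorem aemeasurable (h : IsPearsonSystem P Y t m δ B e) : AEMeasurable Y P :=
  aemeasurable_of_mem_interior_integrableExpSet h.mgf

theorem mgf_map (h : IsPearsonSystem P Y t m δ B e) :
    0 ∈ interior (integrableExpSet id (P.map Y)) :=
  (zero_mem_interior_integrableExpSet_map_iff h.aemeasurable).2 h.mgf

theorem isOrthogonalSystem (h : IsPearsonSystem P Y t m δ B e) :
    IsOrthogonalSystem (P.map Y) (fun k => rodrigues t m B k 1) (fun k => k.factorial * e k) where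
  natDegree_le k := (h.isRaising.hasTopCoeff_rodrigues_one k).1
  nonneg k := mul_nonneg (by positivity) (h.nonneg k)
  integral_mul k u hu := by
    obtain ⟨G, hG0, hG, hGint⟩ := h.exists_chain u
    have hint : ∀ (j : ℕ) (v : ℝ[X]), Integrable (fun ω => v.eval (Y ω) * (G j).eval (Y ω)) P :=
      fun j v => by simpa only [eval_mul] using integrable_eval h.mgf (v * G j)
    have hrod := hG.integral_rodrigues hint k 1
    simp only [hG0, eval_one, one_mul, hGint k hu] at hrod
    rw [integral_map h.aemeasurable (by fun_prop), hrod]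
    ring

theorem eq_zero_or_bounded (h : IsPearsonSystem P Y t m δ B e) :
    δ = 0 ∨ ∃ R, ∀ᵐ ω ∂P, |Y ω| ≤ R := by
  rcases lt_trichotomy δ 0 with hδ | hδ | hδ
  · exact .inr (h.bounded_of_neg hδ)
  · exact .inl hδ
  · obtain ⟨k, hk⟩ : ∃ k, e k = 0 := by
      by_contra! hne
      refine hδ.not_ge (nonpos_of_rodriguesCoeff_pos fun k => ?_)
      rw [← (h.isRaising.hasTopCoeff_rodrigues_one (t := t) (m := m) k).2]
      have hpos := (h.nonneg k).lt_of_ne' (hne k)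
      exact h.isOrthogonalSystem.coeff_pos h.mgf_map (by positivity)
    obtain ⟨s, -, hs⟩ := h.finite_support k hk
    obtain ⟨R, hR⟩ := s.finite_toSet.isBounded.exists_norm_le
    exact .inr ⟨R, hs.mono fun ω hω => hR _ hω⟩

theorem integrable_eval_mul (h : IsPearsonSystem P Y t m δ B e) {G : ℕ → Ω → ℝ}
    (hG : IsSteinChain P Y t m B G) (hint : ∀ j, Integrable (G j) P) (j : ℕ) (u : ℝ[X]) :
    Integrable (fun ω => u.eval (Y ω) * G j ω) P := by
  rcases h.eq_zero_or_bounded with rfl | ⟨R, hR⟩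
  · exact hG.integrable_eval_mul_of_isRaising h.isRaising hint j u
  · exact integrable_eval_mul_of_ae_le h.aemeasurable hR (hint j) u

theorem integral_rodrigues (h : IsPearsonSystem P Y t m δ B e) {g : ℝ → ℝ}
    (hg : MemLp g 2 (P.map Y)) {G : ℕ → Ω → ℝ} (hG : IsSteinChain P Y t m B G)
    (hG0 : ∀ ω, G 0 ω = g (Y ω)) (hint : ∀ j, Integrable (G j) P) (k : ℕ) :
    ∫ x, (rodrigues t m B k 1).eval x * g x ∂P.map Y = ∫ ω, G k ω ∂P := by
  have hmeas : AEStronglyMeasurable (fun x => (rodrigues t m B k 1).eval x) (P.map Y) := by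
    fun_prop
  rw [integral_map h.aemeasurable (hmeas.fun_mul hg.1)]
  simpa only [hG0, eval_one, one_mul] using
    hG.integral_rodrigues (h.integrable_eval_mul hG hint) k 1

theorem hasSum_covariance [IsProbabilityMeasure P] (h : IsPearsonSystem P Y t m δ B e)
    {g₁ g₂ : ℝ → ℝ} (hg₁ : MemLp g₁ 2 (P.map Y)) (hg₂ : MemLp g₂ 2 (P.map Y))
    {G₁ G₂ : ℕ → Ω → ℝ}
    (hG₁ : IsSteinChain P Y t m B G₁) (hG₂ : IsSteinChain P Y t m B G₂)
    (h₁ : ∀ ω, G₁ 0 ω = g₁ (Y ω)) (h₂ : ∀ ω, G₂ 0 ω = g₂ (Y ω))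
    (hint₁ : ∀ k, Integrable (G₁ k) P) (hint₂ : ∀ k, Integrable (G₂ k) P) :
    HasSum (fun n => (∫ ω, G₁ (n + 1) ω ∂P) * (∫ ω, G₂ (n + 1) ω ∂P) /
        ((n + 1).factorial * e (n + 1) * ∏ j ∈ Finset.Icc n (2 * n), (1 - (j : ℝ) * δ)))
      (cov[fun ω => g₁ (Y ω), fun ω => g₂ (Y ω); P]) := by
  have := Measure.isProbabilityMeasure_map (μ := P) h.aemeasurable
  have hsupp : ∀ k, k.factorial * e k = 0 →
      ∃ s : Finset ℝ, s.card = k ∧ ∀ᵐ x ∂P.map Y, x ∈ s := fun k hk => by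
    obtain ⟨s, hcard, hs⟩ := h.finite_support k
      ((mul_eq_zero_iff_left (by positivity)).1 hk)
    exact ⟨s, hcard, (ae_map_iff h.aemeasurable s.measurableSet).2 hs⟩
  have hsum := h.isOrthogonalSystem.hasSum_covariance h.mgf_map hsupp rfl hg₁ hg₂
  rw [covariance_map_fun hg₁.1 hg₂.1 h.aemeasurable] at hsum
  simpa only [h.integral_rodrigues hg₁ hG₁ h₁ hint₁, h.integral_rodrigues hg₂ hG₂ h₂ hint₂,
    (h.isRaising.hasTopCoeff_rodrigues_one _).2, rodriguesCoeff_succ] using hsum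

end IsPearsonSystem

section SteinIdentity

variable {α : Type*} [LinearOrder α] {ι : α → ℝ}

/-- The nonnegative kernel that represents `(ι x - m) (h x - h c)` as an integral of the
derivative of `h`. -/
noncomputable def steinKernel (ι : α → ℝ) (m : ℝ) (c x t : α) : ℝ :=
  (Set.Ico c x).indicator (fun _ => ι x - m) t + (Set.Ico x c).indicator (fun _ => m - ι x) t

theorem steinKernel_nonneg {m : ℝ} {c : α} (hlow : ∀ x < c, ι x ≤ m) (hup : ∀ x > c, m ≤ ι x)
    (x t : α) : 0 ≤ steinKernel ι m c x t :=
  add_nonneg (Set.indicator_apply_nonneg fun ht => sub_nonneg.2 (hup x (ht.1.trans_lt ht.2)))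
    (Set.indicator_apply_nonneg fun ht => sub_nonneg.2 (hlow x (ht.1.trans_lt ht.2)))

theorem steinKernel_of_le {c t : α} (h : c ≤ t) (m : ℝ) :
    (fun x => steinKernel ι m c x t) = (Set.Ioi t).indicator fun x => ι x - m := by
  funext x
  simp [steinKernel, Set.indicator_apply, h]

theorem steinKernel_of_lt {c t : α} (h : t < c) (m : ℝ) :
    (fun x => steinKernel ι m c x t) = (Set.Iic t).indicator fun x => m - ι x := by
  funext x
  simp [steinKernel, Set.indicator_apply, h]

variable [MeasurableSpace α] {μ : Measure α}

/-- The numerator of the Stein kernel of `ι` under `μ`. The Pearson and Ord identities say that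
it is `q` times the density. -/
noncomputable def steinWeight (μ : Measure α) (ι : α → ℝ) (t : α) : ℝ :=
  ∫ x in Set.Iic t, (μ[ι] - ι x) ∂μ

variable [TopologicalSpace α] [OrderClosedTopology α] [OpensMeasurableSpace α]
  [IsProbabilityMeasure μ]

theorem steinWeight_eq_setIntegral_Ioi (hι : Integrable ι μ) (t : α) :
    steinWeight μ ι t = ∫ x in Set.Ioi t, (ι x - μ[ι]) ∂μ := by
  have hsum := integral_add_compl (measurableSet_Iic (a := t)) (hι.sub (integrable_const μ[ι]))
  have hmean : ∫ x, (ι x - μ[ι]) ∂μ = 0 := by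
    rw [integral_sub hι (integrable_const _)]
    simp
  have hneg : steinWeight μ ι t = -∫ x in Set.Iic t, (ι x - μ[ι]) ∂μ := by
    rw [steinWeight, ← integral_neg]
    simp
  rw [Set.compl_Iic] at hsum
  simp only [Pi.sub_apply] at hsum
  linarith

theorem steinWeight_eq (hι : Integrable ι μ) (t : α) :
    steinWeight μ ι t = μ.real (Set.Iic t) * (∫ x in Set.Ioi t, (ι x - ι t) ∂μ) +
      μ.real (Set.Ioi t) * ∫ x in Set.Iic t, (ι t - ι x) ∂μ := by
  have htotal := integral_add_compl (measurableSet_Iic (a := t)) hι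
  have hprob := probReal_add_probReal_compl (μ := μ) (measurableSet_Iic (a := t))
  rw [Set.compl_Iic] at htotal hprob
  have hconst : ∀ (s : Set α) (c : ℝ), Integrable (fun _ => c) (μ.restrict s) := fun s c =>
    integrable_const c
  rw [steinWeight, integral_sub (hconst _ _) hι.integrableOn,
    integral_sub hι.integrableOn (hconst _ _), integral_sub (hconst _ _) hι.integrableOn]
  simp only [setIntegral_const, smul_eq_mul]
  rw [← htotal, eq_sub_of_add_eq' hprob]
  ring

theorem steinWeight_nonneg (hι : Integrable ι μ) (hmono : Monotone ι) (t : α) :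
    0 ≤ steinWeight μ ι t := by
  rw [steinWeight_eq hι]
  have hupper : 0 ≤ ∫ x in Set.Ioi t, (ι x - ι t) ∂μ :=
    setIntegral_nonneg measurableSet_Ioi fun x hx => sub_nonneg.2 (hmono (le_of_lt hx))
  have hlower : 0 ≤ ∫ x in Set.Iic t, (ι t - ι x) ∂μ :=
    setIntegral_nonneg measurableSet_Iic fun x hx => sub_nonneg.2 (hmono hx)
  positivity

theorem steinWeight_pos_iff (hι : Integrable ι μ) (hmono : StrictMono ι) (t : α) :
    0 < steinWeight μ ι t ↔ 0 < μ (Set.Iic t) ∧ 0 < μ (Set.Ioi t) := by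
  refine ⟨fun hpos => ⟨?_, ?_⟩, fun ⟨hlower, hupper⟩ => ?_⟩
  · refine pos_iff_ne_zero.2 fun h0 => hpos.ne' ?_
    rw [steinWeight, setIntegral_measure_zero _ h0]
  · refine pos_iff_ne_zero.2 fun h0 => hpos.ne' ?_
    rw [steinWeight_eq_setIntegral_Ioi hι, setIntegral_measure_zero _ h0]
  · have hsupp : Set.Ioi t ⊆ Function.support fun x => ι x - ι t :=
      fun x hx => (sub_pos.2 (hmono hx)).ne'
    have hIoi : 0 < ∫ x in Set.Ioi t, (ι x - ι t) ∂μ := by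
      rw [setIntegral_pos_iff_support_of_nonneg_ae
        (ae_restrict_of_forall_mem measurableSet_Ioi fun x hx => sub_nonneg.2 (hmono hx).le)
        (hι.sub (integrable_const _)).integrableOn, Set.inter_eq_right.2 hsupp]
      exact hupper
    have hIic : 0 ≤ ∫ x in Set.Iic t, (ι t - ι x) ∂μ :=
      setIntegral_nonneg measurableSet_Iic fun x hx => sub_nonneg.2 (hmono.monotone hx)
    have hreal : 0 < μ.real (Set.Iic t) := ENNReal.toReal_pos hlower.ne' (measure_ne_top _ _)
    rw [steinWeight_eq hι]
    positivity

theorem ordConnected_steinWeight_pos (hι : Integrable ι μ) (hmono : StrictMono ι) :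
    {t | 0 < steinWeight μ ι t}.OrdConnected := by
  refine ⟨fun a ha b hb t ht => ?_⟩
  rw [Set.mem_ofPred_eq, steinWeight_pos_iff hι hmono] at *
  exact ⟨ha.1.trans_le (measure_mono (Set.Iic_subset_Iic.2 ht.1)),
    hb.2.trans_le (measure_mono (Set.Ioi_subset_Ioi ht.2))⟩

theorem continuous_steinWeight {μ : Measure ℝ} [IsFiniteMeasure μ] [NullSingletonClass μ]
    {ι : ℝ → ℝ} (hι : Integrable ι μ) : Continuous (steinWeight μ ι) := by
  have hint : Integrable (fun x => μ[ι] - ι x) μ := (integrable_const _).sub hι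
  have hprim : steinWeight μ ι =
      fun t => steinWeight μ ι 0 + ∫ x in (0 : ℝ)..t, (μ[ι] - ι x) ∂μ := by
    funext t
    rw [← intervalIntegral.integral_Iic_sub_Iic hint.integrableOn hint.integrableOn]
    simp only [steinWeight, add_sub_cancel]
  rw [hprim]
  exact continuous_const.add (hint.continuous_primitive 0)

theorem integral_steinKernel_mul {ν : Measure α} (m : ℝ) (c x : α) (ψ : α → ℝ) :
    ∫ t, steinKernel ι m c x t * ψ t ∂ν =
      (ι x - m) * ((∫ t in Set.Ico c x, ψ t ∂ν) - ∫ t in Set.Ico x c, ψ t ∂ν) := by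
  rcases le_total c x with h | h
  · simp [steinKernel, Set.Ico_eq_empty_of_le h, ← Set.indicator_mul_left,
      integral_indicator measurableSet_Ico, integral_const_mul]
  · simp only [steinKernel, Set.Ico_eq_empty_of_le h, ← Set.indicator_mul_left,
      Set.indicator_empty, zero_add, setIntegral_empty, zero_sub,
      integral_indicator measurableSet_Ico, integral_const_mul]
    ring

theorem integrable_steinKernel {ν : Measure α} [IsFiniteMeasure ν] (hι : Integrable ι ν) (m : ℝ)
    (c t : α) : Integrable (fun x => steinKernel ι m c x t) ν := by
  rcases le_or_gt c t with h | h
  · rw [steinKernel_of_le h]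
    exact (hι.sub (integrable_const m)).indicator measurableSet_Ioi
  · rw [steinKernel_of_lt h]
    exact ((integrable_const m).sub hι).indicator measurableSet_Iic

theorem integral_steinKernel (hι : Integrable ι μ) (c t : α) :
    ∫ x, steinKernel ι μ[ι] c x t ∂μ = steinWeight μ ι t := by
  rcases le_or_gt c t with h | h
  · rw [steinKernel_of_le h, integral_indicator measurableSet_Ioi,
      steinWeight_eq_setIntegral_Ioi hι]
  · rw [steinKernel_of_lt h, integral_indicator measurableSet_Iic, steinWeight]

variable [SecondCountableTopology α]

theorem measurable_steinKernel (hι : Measurable ι) (m : ℝ) (c : α) :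
    Measurable (Function.uncurry (steinKernel ι m c)) := by
  have hfst : Measurable fun p : α × α => ι p.1 := hι.comp measurable_fst
  have hIoi : MeasurableSet {p : α × α | c ≤ p.2 ∧ p.2 < p.1} :=
    (measurableSet_le measurable_const measurable_snd).inter
      (measurableSet_lt measurable_snd measurable_fst)
  have hIio : MeasurableSet {p : α × α | p.1 ≤ p.2 ∧ p.2 < c} :=
    (measurableSet_le measurable_fst measurable_snd).inter
      (measurableSet_lt measurable_snd measurable_const)
  exact ((hfst.sub_const m).indicator hIoi).add ((hfst.const_sub m).indicator hIio)

theorem integrable_prod_steinKernel_mul {ν : Measure α} [SFinite ν] (hmeas : Measurable ι)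
    (hι : Integrable ι μ) {c : α} (hlow : ∀ x < c, ι x ≤ μ[ι]) (hup : ∀ x > c, μ[ι] ≤ ι x)
    {ψ : α → ℝ} (hψ : AEStronglyMeasurable ψ ν)
    (hint : Integrable (fun t => steinWeight μ ι t * ψ t) ν) :
    Integrable (fun p : α × α => steinKernel ι μ[ι] c p.1 p.2 * ψ p.2) (μ.prod ν) := by
  have hkernel : AEStronglyMeasurable (fun p : α × α => steinKernel ι μ[ι] c p.1 p.2 * ψ p.2)
      (μ.prod ν) :=
    (measurable_steinKernel hmeas _ c).aestronglyMeasurable.mul hψ.comp_snd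
  rw [integrable_prod_iff' hkernel]
  refine ⟨ae_of_all _ fun t => (integrable_steinKernel hι _ c t).mul_const (ψ t), ?_⟩
  refine hint.norm.congr (ae_of_all _ fun t => ?_)
  have hweight : 0 ≤ steinWeight μ ι t := by
    rw [← integral_steinKernel hι c]
    exact integral_nonneg fun x => steinKernel_nonneg hlow hup x t
  simp only [norm_mul, Real.norm_of_nonneg (steinKernel_nonneg hlow hup _ _), integral_mul_const,
    integral_steinKernel hι, Real.norm_of_nonneg hweight]

/-- The increments of `h` are the integrals of `ψ` for `ψ = h'` and `ν` the Lebesgue measure, or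
`ψ = Δh` and `ν` the counting measure. -/
theorem integral_sub_mean_mul {ν : Measure α} [SFinite ν] (hmeas : Measurable ι)
    (hι : Integrable ι μ) {c : α} (hlow : ∀ x < c, ι x ≤ μ[ι]) (hup : ∀ x > c, μ[ι] ≤ ι x)
    {ψ h : α → ℝ} (hψ : AEStronglyMeasurable ψ ν)
    (hint : Integrable (fun t => steinWeight μ ι t * ψ t) ν)
    (hh : ∀ᵐ x ∂μ, (∫ t in Set.Ico c x, ψ t ∂ν) - ∫ t in Set.Ico x c, ψ t ∂ν = h x - h c) :
    Integrable (fun x => (ι x - μ[ι]) * h x) μ ∧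
      ∫ x, (ι x - μ[ι]) * h x ∂μ = ∫ t, steinWeight μ ι t * ψ t ∂ν := by
  have hprod := integrable_prod_steinKernel_mul hmeas hι hlow hup hψ hint
  have hcenter : Integrable (fun x => ι x - μ[ι]) μ := hι.sub (integrable_const _)
  have hmean : ∫ x, (ι x - μ[ι]) ∂μ = 0 := by
    rw [integral_sub hι (integrable_const _)]
    simp
  have hsplit : ∀ᵐ x ∂μ, (∫ t, steinKernel ι μ[ι] c x t * ψ t ∂ν) + h c * (ι x - μ[ι]) =
      (ι x - μ[ι]) * h x := by
    filter_upwards [hh] with x hx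
    rw [integral_steinKernel_mul, hx]
    ring
  have hleft := hprod.integral_prod_left
  refine ⟨(hleft.add (hcenter.const_mul (h c))).congr hsplit, ?_⟩
  rw [← integral_congr_ae hsplit, integral_add hleft (hcenter.const_mul (h c)),
    integral_const_mul, hmean, mul_zero, add_zero, integral_integral_swap hprod]
  simp only [integral_mul_const, integral_steinKernel hι]

end SteinIdentity

/-- The Pearson identity for a random variable `X` in an ordered space with density `f` relative to
`ν`, in the coordinate `ι`. The continuous case is `ι = id` with the Lebesgue measure, the discrete
case `ι = Nat.cast` with the counting measure. -/
structure IsPearsonLaw {Ω α : Type*} [MeasurableSpace Ω] [MeasurableSpace α] [LinearOrder α]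
    (P : Measure Ω) (X : Ω → α) (ι : α → ℝ) (ν : Measure α) (q f : α → ℝ) : Prop where
  aemeasurable : AEMeasurable X P
  integrable : Integrable (fun ω => ι (X ω)) P
  measurable_coord : Measurable ι
  strictMono_coord : StrictMono ι
  measurable_weight : Measurable q
  measurable_density : Measurable f
  density_nonneg : ∀ x, 0 ≤ f x
  law : P.map X = ν.withDensity fun x => ENNReal.ofReal (f x)
  identity : ∀ x, ∫ t in Set.Iic x, ((∫ ω, ι (X ω) ∂P) - ι t) * f t ∂ν = q x * f x

namespace IsPearsonLaw

variable {Ω α : Type*} [MeasurableSpace Ω] [MeasurableSpace α] [LinearOrder α]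
  {P : Measure Ω} {X : Ω → α} {ι : α → ℝ} {ν : Measure α} {q f : α → ℝ}

theorem integrable_map_iff (h : IsPearsonLaw P X ι ν q f) {g : α → ℝ} :
    Integrable g (P.map X) ↔ Integrable (fun x => f x * g x) ν := by
  simp only [h.law, integrable_withDensity_ofReal_iff h.measurable_density.aemeasurable,
    max_eq_left (h.density_nonneg _)]

theorem integral_map_eq (h : IsPearsonLaw P X ι ν q f) (g : α → ℝ) :
    ∫ x, g x ∂P.map X = ∫ x, f x * g x ∂ν := by
  simp only [h.law, integral_withDensity_ofReal h.measurable_density.aemeasurable,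
    max_eq_left (h.density_nonneg _)]

theorem integrable_coord (h : IsPearsonLaw P X ι ν q f) : Integrable ι (P.map X) :=
  (integrable_map_measure h.measurable_coord.aestronglyMeasurable h.aemeasurable).2 h.integrable

theorem integral_coord (h : IsPearsonLaw P X ι ν q f) :
    ∫ x, ι x ∂P.map X = ∫ ω, ι (X ω) ∂P :=
  integral_map h.aemeasurable h.measurable_coord.aestronglyMeasurable

theorem absolutelyContinuous (h : IsPearsonLaw P X ι ν q f) : P.map X ≪ ν :=
  h.law ▸ withDensity_absolutelyContinuous _ _

variable [TopologicalSpace α] [OrderClosedTopology α] [OpensMeasurableSpace α]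

theorem steinWeight_map (h : IsPearsonLaw P X ι ν q f) (t : α) :
    steinWeight (P.map X) ι t = q t * f t := by
  rw [steinWeight, h.integral_coord, ← h.identity, ← integral_indicator measurableSet_Iic,
    h.integral_map_eq, ← integral_indicator measurableSet_Iic]
  refine integral_congr_ae (ae_of_all _ fun x => ?_)
  simp only [Set.indicator_apply]
  split_ifs <;> ring

variable [IsProbabilityMeasure P]

theorem weight_mul_density_nonneg (h : IsPearsonLaw P X ι ν q f) (t : α) : 0 ≤ q t * f t := by
  have := Measure.isProbabilityMeasure_map (μ := P) h.aemeasurable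
  rw [← h.steinWeight_map]
  exact steinWeight_nonneg h.integrable_coord h.strictMono_coord.monotone t

theorem weight_mul_density_pos_iff (h : IsPearsonLaw P X ι ν q f) (t : α) :
    0 < q t * f t ↔ 0 < P.map X (Set.Iic t) ∧ 0 < P.map X (Set.Ioi t) := by
  have := Measure.isProbabilityMeasure_map (μ := P) h.aemeasurable
  rw [← h.steinWeight_map, steinWeight_pos_iff h.integrable_coord h.strictMono_coord]

theorem stein_identity [SecondCountableTopology α] [SFinite ν] (h : IsPearsonLaw P X ι ν q f)
    {c : α} (hlow : ∀ x < c, ι x ≤ ∫ ω, ι (X ω) ∂P) (hup : ∀ x > c, ∫ ω, ι (X ω) ∂P ≤ ι x)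
    {ψ g : α → ℝ} (hψ : AEStronglyMeasurable ψ ν)
    (hint : Integrable (fun ω => q (X ω) * ψ (X ω)) P)
    (hg : ∀ᵐ x ∂P.map X,
      (∫ t in Set.Ico c x, ψ t ∂ν) - ∫ t in Set.Ico x c, ψ t ∂ν = g x - g c) :
    Integrable (fun ω => (ι (X ω) - ∫ ω, ι (X ω) ∂P) * g (X ω)) P ∧
      ∫ ω, (ι (X ω) - ∫ ω, ι (X ω) ∂P) * g (X ω) ∂P = ∫ ω, q (X ω) * ψ (X ω) ∂P := by
  have := Measure.isProbabilityMeasure_map (μ := P) h.aemeasurable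
  have hqψ : AEStronglyMeasurable (fun x => q x * ψ x) (P.map X) :=
    h.measurable_weight.aestronglyMeasurable.mul (hψ.mono_ac h.absolutelyContinuous)
  have hweight : ∀ t, steinWeight (P.map X) ι t * ψ t = f t * (q t * ψ t) := fun t => by
    rw [h.steinWeight_map]
    ring
  rw [← h.integral_coord] at *
  obtain ⟨hint', hstein⟩ := integral_sub_mean_mul h.measurable_coord h.integrable_coord hlow hup hψ
    (by simpa only [hweight] using
      h.integrable_map_iff.1 ((integrable_map_measure hqψ h.aemeasurable).2 hint)) hg
  simp only [hweight, ← h.integral_map_eq] at hstein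
  rw [integral_map h.aemeasurable hint'.1, integral_map h.aemeasurable hqψ] at hstein
  exact ⟨hint'.comp_aemeasurable h.aemeasurable, hstein⟩

end IsPearsonLaw

section Quadratic

/-- The quadratic `quad δ β γ` as a polynomial. -/
noncomputable def quadPoly (δ β γ : ℝ) : ℝ[X] :=
  C δ * X ^ 2 + C β * X + C γ

theorem eval_quadPoly (δ β γ x : ℝ) : (quadPoly δ β γ).eval x = quad δ β γ x := by
  simp [quadPoly, quad]

theorem hasTopCoeff_quadPoly (δ β γ : ℝ) : HasTopCoeff (quadPoly δ β γ) 2 δ :=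
  ⟨natDegree_quadratic_le, by simp [quadPoly]⟩

theorem measurable_quad (δ β γ : ℝ) : Measurable (quad δ β γ) := by
  unfold quad
  fun_prop

theorem exists_abs_le_of_quad_nonneg {δ β γ : ℝ} (hδ : δ < 0) :
    ∃ R, ∀ x, 0 ≤ quad δ β γ x → |x| ≤ R := by
  refine ⟨(|β| + |γ|) / (-δ) + 1, fun x hx => ?_⟩
  by_contra! hlt
  have hδ' : 0 < -δ := neg_pos.2 hδ
  have hone : 1 ≤ |x| := by linarith [div_nonneg (by positivity : 0 ≤ |β| + |γ|) hδ'.le]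
  have hlarge : |β| + |γ| < |x| * (-δ) := (div_lt_iff₀ hδ').1 (by linarith)
  have hlow : β * x + γ ≤ (|β| + |γ|) * |x| := calc
    β * x + γ ≤ |β * x| + |γ| * 1 := by linarith [le_abs_self (β * x), le_abs_self γ]
    _ ≤ (|β| + |γ|) * |x| := by rw [abs_mul, add_mul]; gcongr
  have hlead := mul_lt_mul_of_pos_right hlarge (zero_lt_one.trans_le hone)
  rw [quad, ← sq_abs x] at hx
  linarith

end Quadratic

section Continuous

/-- `derivOp Q j u = Q u' + j Q' u`, so that `Q (u Q^j g)' = u (Q^(j+1) g') + derivOp Q j u (Q^j g)`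
for every function `g`. -/
noncomputable def derivOp (Q : ℝ[X]) (j : ℕ) (u : ℝ[X]) : ℝ[X] :=
  Q * derivative u + C (j : ℝ) * (derivative Q * u)

theorem isRaising_derivOp (δ β γ : ℝ) : IsRaising δ (derivOp (quadPoly δ β γ)) := by
  intro j d u c hu
  have hQ := hasTopCoeff_quadPoly δ β γ
  have hC : HasTopCoeff (C (j : ℝ)) 0 (j : ℝ) := ⟨(natDegree_C _).le, coeff_C_zero⟩
  have hraise := (hQ.quadratic_mul hu.derivative).add
    (by simpa [add_comm 1 d] using hC.mul (hQ.derivative.mul hu))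
  rwa [show δ * (d * c) + j * (2 * δ * c) = (2 * j + d) * δ * c by ring] at hraise

/-- The open interval on which the identity forces the density to be positive: the set `{f > 0}`
may contain further points, but only zeros of `q`. -/
def steinSupport (δ β γ : ℝ) (f : ℝ → ℝ) : Set ℝ :=
  {x | 0 < quad δ β γ x * f x}

theorem hasDerivAt_iteratedDeriv {U : Set ℝ} (hU : IsOpen U) {g : ℝ → ℝ}
    (hg : ContDiffOn ℝ ((⊤ : ℕ∞) : WithTop ℕ∞) g U) (k : ℕ) {x : ℝ} (hx : x ∈ U) :
    HasDerivAt (iteratedDeriv k g) (iteratedDeriv (k + 1) g x) x := by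
  rw [iteratedDeriv_succ]
  have hdiff := hg.differentiableOn_iteratedDerivWithin (m := k)
    (by exact_mod_cast WithTop.coe_lt_top _) hU.uniqueDiffOn
  exact ((hdiff.congr fun y hy => (iteratedDerivWithin_of_isOpen hU hy).symm).differentiableAt
    (hU.mem_nhds hx)).hasDerivAt

theorem setIntegral_Ico_sub_setIntegral_Ico {S : Set ℝ} (hS : S.OrdConnected) {g g' : ℝ → ℝ}
    (hg : ∀ x ∈ S, HasDerivAt g (g' x) x) (hg' : ContinuousOn g' S) {c x : ℝ} (hc : c ∈ S)
    (hx : x ∈ S) :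
    (∫ t in Set.Ico c x, S.indicator g' t) - ∫ t in Set.Ico x c, S.indicator g' t = g x - g c := by
  have hsub : Set.uIcc c x ⊆ S := hS.uIcc_subset hc hx
  have hindicator : ∀ t ∈ Set.uIcc c x, S.indicator g' t = g' t := fun t ht =>
    Set.indicator_of_mem (hsub ht) g'
  simp only [integral_Ico_eq_integral_Ioc]
  rw [← intervalIntegral, intervalIntegral.integral_congr hindicator]
  exact intervalIntegral.integral_eq_sub_of_hasDerivAt (fun t ht => hg t (hsub ht))
    (hg'.mono hsub).intervalIntegrable

namespace IsContinuous

variable {Ω : Type*} [MeasurableSpace Ω] {P : Measure Ω} {X : Ω → ℝ} {f : ℝ → ℝ} {δ β γ : ℝ}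

theorem isPearsonLaw (h : IsContinuous P X f δ β γ) :
    IsPearsonLaw P X id volume (quad δ β γ) f where
  aemeasurable := h.aemeasurable
  integrable := h.integrable
  measurable_coord := measurable_id
  strictMono_coord := strictMono_id
  measurable_weight := measurable_quad δ β γ
  measurable_density := h.measurable_density
  density_nonneg := h.density_nonneg
  law := h.law
  identity := h.identity

theorem quad_pos (h : IsContinuous P X f δ β γ) {x : ℝ} (hx : x ∈ steinSupport δ β γ f) :
    0 < quad δ β γ x :=
  pos_of_mul_pos_left hx (h.density_nonneg x)

theorem nullSingletonClass_map (h : IsContinuous P X f δ β γ) : NullSingletonClass (P.map X) :=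
  ⟨fun _ => h.isPearsonLaw.absolutelyContinuous (measure_singleton _)⟩

variable [IsProbabilityMeasure P]

theorem ordConnected_steinSupport (h : IsContinuous P X f δ β γ) :
    (steinSupport δ β γ f).OrdConnected := by
  have := Measure.isProbabilityMeasure_map (μ := P) h.aemeasurable
  have hord := ordConnected_steinWeight_pos h.isPearsonLaw.integrable_coord strictMono_id
  simp only [h.isPearsonLaw.steinWeight_map] at hord
  exact hord

theorem isOpen_steinSupport (h : IsContinuous P X f δ β γ) : IsOpen (steinSupport δ β γ f) := by
  have := Measure.isProbabilityMeasure_map (μ := P) h.aemeasurable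
  have := h.nullSingletonClass_map
  refine isOpen_lt continuous_const ?_
  simpa only [← h.isPearsonLaw.steinWeight_map] using
    continuous_steinWeight h.isPearsonLaw.integrable_coord

theorem steinSupport_subset_openSupport (h : IsContinuous P X f δ β γ) :
    steinSupport δ β γ f ⊆ openSupport f :=
  interior_maximal (fun _ hx => pos_of_mul_pos_right hx (h.quad_pos hx).le) h.isOpen_steinSupport

theorem mean_mem_steinSupport (h : IsContinuous P X f δ β γ) :
    ∫ ω, X ω ∂P ∈ steinSupport δ β γ f := by
  have := Measure.isProbabilityMeasure_map (μ := P) h.aemeasurable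
  have := h.nullSingletonClass_map
  have hmean : ∫ x, x ∂P.map X = ∫ ω, X ω ∂P := h.isPearsonLaw.integral_coord
  have hlower := measure_le_integral_pos h.isPearsonLaw.integrable_coord
  have hupper := measure_integral_le_pos h.isPearsonLaw.integrable_coord
  simp only [id, hmean] at hlower hupper
  refine (h.isPearsonLaw.weight_mul_density_pos_iff _).2 ⟨hlower, ?_⟩
  rwa [measure_congr Ioi_ae_eq_Ici]

theorem ae_mem_steinSupport (h : IsContinuous P X f δ β γ) :
    ∀ᵐ ω ∂P, X ω ∈ steinSupport δ β γ f := by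
  have hQ : quadPoly δ β γ ≠ 0 := fun h0 => (h.quad_pos h.mean_mem_steinSupport).ne' <| by
    rw [← eval_quadPoly, h0, eval_zero]
  have hroot : ∀ᵐ x : ℝ, quad δ β γ x ≠ 0 := by
    filter_upwards [((quadPoly δ β γ).roots.toFinset.countable_toSet).ae_notMem volume]
      with x hx h0
    exact hx (by simpa [hQ, eval_quadPoly] using h0)
  refine ae_of_ae_map h.aemeasurable ?_
  rw [h.law, ae_withDensity_iff h.measurable_density.ennreal_ofReal]
  filter_upwards [hroot] with x hx hfx
  refine (h.isPearsonLaw.weight_mul_density_nonneg x).lt_of_ne' (mul_ne_zero hx fun h0 => ?_)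
  simp [h0] at hfx

theorem stein_identity (h : IsContinuous P X f δ β γ) {g g' : ℝ → ℝ}
    (hg : ∀ x ∈ steinSupport δ β γ f, HasDerivAt g (g' x) x)
    (hg' : ContinuousOn g' (steinSupport δ β γ f))
    (hint : Integrable (fun ω => quad δ β γ (X ω) * g' (X ω)) P) :
    Integrable (fun ω => (X ω - ∫ ω, X ω ∂P) * g (X ω)) P ∧
      ∫ ω, (X ω - ∫ ω, X ω ∂P) * g (X ω) ∂P = ∫ ω, quad δ β γ (X ω) * g' (X ω) ∂P := by
  have hmeas := h.isOpen_steinSupport.measurableSet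
  have hind : ∀ᵐ ω ∂P, quad δ β γ (X ω) * g' (X ω) =
      quad δ β γ (X ω) * (steinSupport δ β γ f).indicator g' (X ω) :=
    h.ae_mem_steinSupport.mono fun ω hω => by rw [Set.indicator_of_mem hω]
  rw [integral_congr_ae hind]
  exact h.isPearsonLaw.stein_identity (c := ∫ ω, X ω ∂P) (fun _ => le_of_lt) (fun _ => le_of_lt)
    ((aestronglyMeasurable_indicator_iff hmeas).2 (hg'.aestronglyMeasurable hmeas))
    (hint.congr hind)
    (((ae_map_iff h.aemeasurable hmeas).2 h.ae_mem_steinSupport).mono fun x hx =>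
      setIntegral_Ico_sub_setIntegral_Ico h.ordConnected_steinSupport hg hg'
        h.mean_mem_steinSupport hx)

theorem isSteinChain (h : IsContinuous P X f δ β γ) {D : ℕ → ℝ → ℝ}
    (hD : ∀ j, ∀ x ∈ steinSupport δ β γ f, HasDerivAt (D j) (D (j + 1) x) x) :
    IsSteinChain P X 0 (∫ ω, X ω ∂P) (derivOp (quadPoly δ β γ))
      (fun j ω => quad δ β γ (X ω) ^ j * D j (X ω)) := by
  intro j u hint
  have hquad : ∀ x, HasDerivAt (quad δ β γ) ((derivative (quadPoly δ β γ)).eval x) x := fun x => by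
    simpa only [eval_quadPoly] using (quadPoly δ β γ).hasDerivAt x
  let g' : ℝ → ℝ := fun x => (derivative u).eval x * (quad δ β γ x ^ j * D j x) +
    u.eval x * ((j * quad δ β γ x ^ (j - 1) * (derivative (quadPoly δ β γ)).eval x) * D j x +
      quad δ β γ x ^ j * D (j + 1) x)
  have hweight : ∀ x, quad δ β γ x * g' x =
      (taylor 0 u).eval x * (quad δ β γ x ^ (j + 1) * D (j + 1) x) +
        (derivOp (quadPoly δ β γ) j u).eval x * (quad δ β γ x ^ j * D j x) := by
    intro x
    have hpow : (j : ℝ) * (quad δ β γ x * quad δ β γ x ^ (j - 1)) = j * quad δ β γ x ^ j := by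
      rcases j with _ | j
      · simp
      · rw [Nat.add_sub_cancel, pow_succ']
    simp only [g', derivOp, eval_add, eval_mul, eval_C, taylor_zero, eval_quadPoly]
    linear_combination (u.eval x * (derivative (quadPoly δ β γ)).eval x * D j x) * hpow
  simp only [← hweight] at hint ⊢
  refine h.stein_identity (g := fun x => u.eval x * (quad δ β γ x ^ j * D j x)) (g' := g')
    (fun x hx => (u.hasDerivAt x).mul (((hquad x).pow j).mul (hD j x hx))) ?_ hint
  have hcont : ∀ j, ContinuousOn (D j) (steinSupport δ β γ f) := fun j x hx =>
    (hD j x hx).continuousAt.continuousWithinAt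
  have hcontq : Continuous (quad δ β γ) :=
    continuous_iff_continuousAt.2 fun x => (hquad x).continuousAt
  fun_prop

theorem integral_quad_pow_pos (h : IsContinuous P X f δ β γ) (hmgf : FiniteMGFNearZero X P)
    (k : ℕ) : 0 < ∫ ω, quad δ β γ (X ω) ^ k ∂P := by
  have hpos : ∀ᵐ ω ∂P, 0 < quad δ β γ (X ω) ^ k :=
    h.ae_mem_steinSupport.mono fun ω hω => pow_pos (h.quad_pos hω) k
  have hint : Integrable (fun ω => quad δ β γ (X ω) ^ k) P := by
    simpa [eval_quadPoly] using integrable_eval hmgf.zero_mem_interior (quadPoly δ β γ ^ k)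
  refine (integral_pos_iff_support_of_nonneg_ae (hpos.mono fun ω => le_of_lt) hint).2 ?_
  have hsupport := measure_congr (eventuallyEq_univ.2 (hpos.mono fun ω => ne_of_gt))
  rw [Function.support, hsupport, measure_univ]
  exact one_pos

theorem isPearsonSystem (h : IsContinuous P X f δ β γ) (hmgf : FiniteMGFNearZero X P) :
    IsPearsonSystem P X 0 (∫ ω, X ω ∂P) δ (derivOp (quadPoly δ β γ))
      (fun k => ∫ ω, quad δ β γ (X ω) ^ k ∂P) where
  mgf := hmgf.zero_mem_interior
  isRaising := isRaising_derivOp δ β γ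
  exists_chain u := by
    refine ⟨fun j => quadPoly δ β γ ^ j * derivative^[j] u, by simp, ?_, fun k hk => ?_⟩
    · have hchain := h.isSteinChain (D := fun j x => (derivative^[j] u).eval x) fun j x _ => by
        rw [Function.iterate_succ_apply']
        exact (derivative^[j] u).hasDerivAt x
      simpa only [eval_mul, eval_pow, eval_quadPoly] using hchain
    · have hconst : derivative^[k] u = C (k.factorial * u.coeff k) :=
        HasTopCoeff.iterate_eq_C (fun p d c hp => hp.derivative) k (.of_natDegree_le hk)
      simp only [hconst, eval_mul, eval_pow, eval_C, eval_quadPoly, integral_mul_const]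
      ring
  nonneg k := (h.integral_quad_pow_pos hmgf k).le
  finite_support k hk := absurd hk (h.integral_quad_pow_pos hmgf k).ne'
  bounded_of_neg hδ := by
    obtain ⟨R, hR⟩ := exists_abs_le_of_quad_nonneg (β := β) (γ := γ) hδ
    exact ⟨R, h.ae_mem_steinSupport.mono fun ω hω => hR _ (h.quad_pos hω).le⟩

theorem integrable_quad_pow_mul (h : IsContinuous P X f δ β γ) {D : ℝ → ℝ}
    (hD : ContinuousOn D (steinSupport δ β γ f)) {k : ℕ}
    (hint : Integrable (fun ω => quad δ β γ (X ω) ^ k * |D (X ω)|) P) :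
    Integrable (fun ω => quad δ β γ (X ω) ^ k * D (X ω)) P := by
  have hmeas := h.isOpen_steinSupport.measurableSet
  have hDmeas := hD.aestronglyMeasurable (μ := P.map X) hmeas
  have hmem : ∀ᵐ x ∂P.map X, x ∈ steinSupport δ β γ f :=
    (ae_map_iff h.aemeasurable hmeas).2 h.ae_mem_steinSupport
  rw [Measure.restrict_eq_self_of_ae_mem hmem] at hDmeas
  have hq := ((measurable_quad δ β γ).pow_const k).comp_aemeasurable h.aemeasurable
  refine hint.mono (hq.aestronglyMeasurable.mul (hDmeas.comp_aemeasurable h.aemeasurable))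
    (ae_of_all _ fun ω => by simp)

theorem hasSum_covariance (h : IsContinuous P X f δ β γ)
    (hmgf : FiniteMGFNearZero X P) {g₁ g₂ : ℝ → ℝ}
    (hL₁ : MemLp g₁ 2 (P.map X)) (hL₂ : MemLp g₂ 2 (P.map X))
    (hs₁ : ContDiffOn ℝ ((⊤ : ℕ∞) : WithTop ℕ∞) g₁ (openSupport f))
    (hs₂ : ContDiffOn ℝ ((⊤ : ℕ∞) : WithTop ℕ∞) g₂ (openSupport f))
    (hI₁ : ∀ k, Integrable (fun ω => quad δ β γ (X ω) ^ k * |iteratedDeriv k g₁ (X ω)|) P)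
    (hI₂ : ∀ k, Integrable (fun ω => quad δ β γ (X ω) ^ k * |iteratedDeriv k g₂ (X ω)|) P) :
    HasSum (fun n => (∫ ω, quad δ β γ (X ω) ^ (n + 1) * iteratedDeriv (n + 1) g₁ (X ω) ∂P) *
        (∫ ω, quad δ β γ (X ω) ^ (n + 1) * iteratedDeriv (n + 1) g₂ (X ω) ∂P) /
        ((n + 1).factorial * (∫ ω, quad δ β γ (X ω) ^ (n + 1) ∂P) *
          ∏ j ∈ Finset.Icc n (2 * n), (1 - (j : ℝ) * δ)))
      (cov[fun ω => g₁ (X ω), fun ω => g₂ (X ω); P]) := by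
  have hderiv : ∀ {g : ℝ → ℝ}, ContDiffOn ℝ ((⊤ : ℕ∞) : WithTop ℕ∞) g (openSupport f) →
      ∀ k, ∀ x ∈ steinSupport δ β γ f,
        HasDerivAt (iteratedDeriv k g) (iteratedDeriv (k + 1) g x) x := fun hg k x hx =>
    hasDerivAt_iteratedDeriv isOpen_interior hg k (h.steinSupport_subset_openSupport hx)
  have hcont : ∀ {g : ℝ → ℝ}, ContDiffOn ℝ ((⊤ : ℕ∞) : WithTop ℕ∞) g (openSupport f) →
      ∀ k, ContinuousOn (iteratedDeriv k g) (steinSupport δ β γ f) := fun hg k x hx =>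
    (hderiv hg k x hx).continuousAt.continuousWithinAt
  have hchain₁ := h.isSteinChain (hderiv hs₁)
  have hchain₂ := h.isSteinChain (hderiv hs₂)
  have hsum := (h.isPearsonSystem hmgf).hasSum_covariance hL₁ hL₂ hchain₁ hchain₂
    (fun ω => by simp only [pow_zero, one_mul, iteratedDeriv_zero])
    (fun ω => by simp only [pow_zero, one_mul, iteratedDeriv_zero])
    (fun k => h.integrable_quad_pow_mul (hcont hs₁ k) (hI₁ k))
    (fun k => h.integrable_quad_pow_mul (hcont hs₂ k) (hI₂ k))
  exact hsum

end IsContinuous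

end Continuous

section Discrete

theorem ascQuad_succ (δ β γ : ℝ) (k : ℕ) (x : ℝ) :
    ascQuad δ β γ (k + 1) x = ascQuad δ β γ k x * quad δ β γ (x + k) :=
  Finset.prod_range_succ _ _

theorem ascQuad_succ' (δ β γ : ℝ) (k : ℕ) (x : ℝ) :
    ascQuad δ β γ (k + 1) x = quad δ β γ x * ascQuad δ β γ k (x + 1) := by
  simp only [ascQuad, Finset.prod_range_succ', mul_comm (quad δ β γ x), Nat.cast_zero, add_zero,
    Nat.cast_add_one, add_assoc, add_comm (1 : ℝ)]

/-- The ascending product `ascQuad δ β γ k` as a polynomial. -/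
noncomputable def ascPoly (δ β γ : ℝ) (k : ℕ) : ℝ[X] :=
  ∏ i ∈ Finset.range k, taylor (i : ℝ) (quadPoly δ β γ)

theorem eval_ascPoly (δ β γ : ℝ) (k : ℕ) (x : ℝ) :
    (ascPoly δ β γ k).eval x = ascQuad δ β γ k x := by
  simp only [ascPoly, ascQuad, eval_prod, taylor_eval, eval_quadPoly]

/-- The discrete counterpart of `derivOp`: `Q Δ(u Q^[j] g) =
u(· + 1) (Q^[j+1] Δg) + fwdDiffOp Q j u (Q^[j] g)` for every function `g`. -/
noncomputable def fwdDiffOp (Q : ℝ[X]) (j : ℕ) (u : ℝ[X]) : ℝ[X] :=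
  taylor 1 u * taylor (j : ℝ) Q - u * Q

theorem isRaising_fwdDiffOp (δ β γ : ℝ) : IsRaising δ (fwdDiffOp (quadPoly δ β γ)) := by
  intro j d u c hu
  let Q := quadPoly δ β γ
  have hQ : HasTopCoeff Q 2 δ := hasTopCoeff_quadPoly δ β γ
  have hdiff : HasTopCoeff (taylor 1 u - u) (d - 1) (d * c) := by
    simpa only [one_mul] using hu.taylor_sub 1
  have hraise := ((hQ.taylor j).quadratic_mul hdiff).add (hu.mul (hQ.taylor_sub j))
  rw [show (2 * j + d) * δ * c = δ * (d * c) + c * (j * ((2 : ℕ) * δ)) by push_cast; ring,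
    show fwdDiffOp Q j u = taylor (j : ℝ) Q * (taylor 1 u - u) + u * (taylor (j : ℝ) Q - Q) by
      rw [fwdDiffOp]; ring]
  exact hraise

theorem ae_comp_iff_forall_pos {Ω α : Type*} [MeasurableSpace Ω] [Countable α] {P : Measure Ω}
    [IsFiniteMeasure P] {X : Ω → α} {p : α → Prop} :
    (∀ᵐ ω ∂P, p (X ω)) ↔ ∀ a, 0 < P.real {ω | X ω = a} → p a := by
  have hfiber : (∀ᵐ ω ∂P, p (X ω)) ↔ ∀ a, ∀ᵐ ω ∂P, X ω = a → p a := by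
    rw [← ae_all_iff]
    simp
  rw [hfiber]
  refine forall_congr' fun a => ?_
  by_cases ha : p a
  · simp [ha]
  · simp [ha, ae_iff, measureReal_def, ENNReal.toReal_pos_iff]

theorem setIntegral_count_finset (g : ℕ → ℝ) (s : Finset ℕ) :
    ∫ n in s, g n ∂Measure.count = ∑ n ∈ s, g n := by
  have hint : IntegrableOn g s Measure.count := by
    rw [← Set.biUnion_of_singleton (s : Set ℕ)]
    simp only [Finset.mem_coe, integrableOn_finset_iUnion]
    intro n _
    simp
  simp [setIntegral_finset s hint]

theorem setIntegral_count_Ico_sub_setIntegral_count_Ico (g : ℕ → ℝ) (a b : ℕ) :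
    (∫ n in Set.Ico a b, (g (n + 1) - g n) ∂Measure.count) -
      ∫ n in Set.Ico b a, (g (n + 1) - g n) ∂Measure.count = g b - g a := by
  rw [← Finset.coe_Ico, ← Finset.coe_Ico, setIntegral_count_finset, setIntegral_count_finset]
  rcases le_total a b with hab | hab
  · rw [Finset.Ico_eq_empty_of_le hab, Finset.sum_Ico_sub _ hab]
    simp
  · rw [Finset.Ico_eq_empty_of_le hab, Finset.sum_Ico_sub _ hab]
    simp

namespace IsDiscrete

variable {Ω : Type*} [MeasurableSpace Ω] {P : Measure Ω} {X : Ω → ℕ} {δ β γ : ℝ}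

theorem integrable_ascQuad (hmgf : FiniteMGFNearZero (fun ω => (X ω : ℝ)) P) (k : ℕ) :
    Integrable (fun ω => ascQuad δ β γ k (X ω)) P := by
  simpa only [eval_ascPoly] using integrable_eval hmgf.zero_mem_interior (ascPoly δ β γ k)

theorem integrable_ascQuad_mul (h : IsDiscrete P X δ β γ) {D : ℕ → ℝ} {k : ℕ}
    (hint : Integrable (fun ω => ascQuad δ β γ k (X ω) * |D (X ω)|) P) :
    Integrable (fun ω => ascQuad δ β γ k (X ω) * D (X ω)) P := by
  have hmeas : Measurable fun n : ℕ => ascQuad δ β γ k n * D n := measurable_from_nat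
  exact hint.mono (hmeas.comp_aemeasurable h.aemeasurable).aestronglyMeasurable
    (ae_of_all _ fun ω => by simp)

theorem memLp_floor (h : IsDiscrete P X δ β γ) {g : ℕ → ℝ} (hg : MemLp g 2 (P.map X)) :
    MemLp (fun x : ℝ => g ⌊x⌋₊) 2 (P.map fun ω => (X ω : ℝ)) := by
  have hfloor : Measurable fun x : ℝ => g ⌊x⌋₊ := measurable_from_nat.comp Nat.measurable_floor
  have hcast : AEMeasurable (fun ω => (X ω : ℝ)) P :=
    measurable_from_nat.comp_aemeasurable h.aemeasurable
  rw [memLp_map_measure_iff hfloor.aestronglyMeasurable hcast]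
  simpa only [Function.comp_def, Nat.floor_natCast] using
    (memLp_map_measure_iff hg.1 h.aemeasurable).1 hg

variable [IsProbabilityMeasure P]

theorem isPearsonLaw (h : IsDiscrete P X δ β γ) :
    IsPearsonLaw P X (Nat.cast : ℕ → ℝ) Measure.count (fun n => quad δ β γ n)
      (fun n => P.real {ω | X ω = n}) where
  aemeasurable := h.aemeasurable
  integrable := h.integrable
  measurable_coord := measurable_from_nat
  strictMono_coord := Nat.strictMono_cast
  measurable_weight := measurable_from_nat
  measurable_density := measurable_from_nat
  density_nonneg _ := measureReal_nonneg
  law := Measure.ext_of_singleton fun n => by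
    rw [withDensity_apply _ (measurableSet_singleton n), lintegral_singleton,
      Measure.map_apply_of_aemeasurable h.aemeasurable (measurableSet_singleton n)]
    simp only [Measure.count_singleton, mul_one]
    exact (ofReal_measureReal (measure_ne_top P _)).symm
  identity n := by
    rw [← h.identity n, show Set.Iic n = ↑(Finset.range (n + 1)) by ext; simp,
      setIntegral_count_finset]

theorem stein_identity (h : IsDiscrete P X δ β γ) {g : ℕ → ℝ}
    (hint : Integrable (fun ω => quad δ β γ (X ω) * (g (X ω + 1) - g (X ω))) P) :
    Integrable (fun ω => (X ω - ∫ ω, (X ω : ℝ) ∂P) * g (X ω)) P ∧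
      ∫ ω, (X ω - ∫ ω, (X ω : ℝ) ∂P) * g (X ω) ∂P =
        ∫ ω, quad δ β γ (X ω) * (g (X ω + 1) - g (X ω)) ∂P := by
  have hmean : 0 ≤ ∫ ω, (X ω : ℝ) ∂P := integral_nonneg fun ω => Nat.cast_nonneg _
  exact h.isPearsonLaw.stein_identity (c := ⌊∫ ω, (X ω : ℝ) ∂P⌋₊)
    (fun n hn => (Nat.cast_le.2 hn.le).trans (Nat.floor_le hmean))
    (fun n hn => (Nat.lt_of_floor_lt hn).le) (ψ := fun n => g (n + 1) - g n)
    measurable_from_nat.aestronglyMeasurable hint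
    (ae_of_all _ fun n => setIntegral_count_Ico_sub_setIntegral_count_Ico g _ n)

theorem isSteinChain (h : IsDiscrete P X δ β γ) {D : ℕ → ℕ → ℝ}
    (hD : ∀ j n, D (j + 1) n = D j (n + 1) - D j n) :
    IsSteinChain P (fun ω => (X ω : ℝ)) 1 (∫ ω, (X ω : ℝ) ∂P) (fwdDiffOp (quadPoly δ β γ))
      (fun j ω => ascQuad δ β γ j (X ω) * D j (X ω)) := by
  intro j u hint
  let g : ℕ → ℝ := fun n => u.eval (n : ℝ) * (ascQuad δ β γ j n * D j n)
  have hweight : ∀ n : ℕ, quad δ β γ n * (g (n + 1) - g n) =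
      (taylor 1 u).eval (n : ℝ) * (ascQuad δ β γ (j + 1) n * D (j + 1) n) +
        (fwdDiffOp (quadPoly δ β γ) j u).eval (n : ℝ) * (ascQuad δ β γ j n * D j n) := by
    intro n
    have hshift : quad δ β γ n * ascQuad δ β γ j (n + 1) =
        ascQuad δ β γ j n * quad δ β γ (n + j) := by
      rw [← ascQuad_succ, ascQuad_succ']
    simp only [g, fwdDiffOp, eval_sub, eval_mul, taylor_eval, eval_quadPoly, hD, ascQuad_succ,
      Nat.cast_add_one]
    linear_combination (u.eval (n + 1 : ℝ) * D j (n + 1)) * hshift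
  simp only [← hweight] at hint ⊢
  exact h.stein_identity hint

theorem quad_eq_zero_or_pos (h : IsDiscrete P X δ β γ) {n : ℕ} (hn : 0 < P.real {ω | X ω = n}) :
    quad δ β γ n = 0 ∨ 0 < quad δ β γ n ∧ 0 < P.real {ω | X ω = n + 1} := by
  have hnonneg : 0 ≤ quad δ β γ n :=
    nonneg_of_mul_nonneg_left (h.isPearsonLaw.weight_mul_density_nonneg n) hn
  rcases hnonneg.eq_or_lt with hzero | hpos
  · exact .inl hzero.symm
  refine .inr ⟨hpos, measureReal_nonneg.lt_of_ne' fun hnext => ?_⟩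
  have hidentity := h.identity (n + 1)
  rw [Finset.sum_range_succ, h.identity n, hnext, mul_zero, mul_zero, add_zero] at hidentity
  exact (mul_pos hpos hn).ne' hidentity

theorem ascQuad_eq_zero_or_pos (h : IsDiscrete P X δ β γ) {n : ℕ}
    (hn : 0 < P.real {ω | X ω = n}) (k : ℕ) :
    ascQuad δ β γ k n = 0 ∨ 0 < ascQuad δ β γ k n ∧ 0 < P.real {ω | X ω = n + k} := by
  induction k with
  | zero => simp [ascQuad, hn]
  | succ k ih =>
    rw [ascQuad_succ]
    rcases ih with hzero | ⟨hpos, hk⟩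
    · exact .inl (by rw [hzero, zero_mul])
    · rcases h.quad_eq_zero_or_pos hk with hzero' | ⟨hpos', hk'⟩
      · exact .inl (by rw [← Nat.cast_add, hzero', mul_zero])
      · exact .inr ⟨mul_pos hpos (by exact_mod_cast hpos'), hk'⟩

theorem ascQuad_nonneg (h : IsDiscrete P X δ β γ) (k : ℕ) :
    ∀ᵐ ω ∂P, 0 ≤ ascQuad δ β γ k (X ω) :=
  ae_comp_iff_forall_pos (p := fun n : ℕ => 0 ≤ ascQuad δ β γ k n).2 fun _ hn =>
    (h.ascQuad_eq_zero_or_pos hn k).elim ge_of_eq fun hpos => hpos.1.le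

theorem ae_lt_of_ascQuad_eq_zero (h : IsDiscrete P X δ β γ) {r k : ℕ}
    (hr : 0 < P.real {ω | X ω = r}) (hk : ascQuad δ β γ k r = 0) : ∀ᵐ ω ∂P, X ω < r + k := by
  obtain ⟨i, hi, hzero⟩ := Finset.prod_eq_zero_iff.1 hk
  have hlower : 0 < P.map X (Set.Iic (r + i)) := by
    rw [Measure.map_apply_of_aemeasurable h.aemeasurable measurableSet_Iic]
    exact (ENNReal.toReal_pos_iff.1 hr).1.trans_le
      (measure_mono fun ω (hω : X ω = r) => hω.trans_le (Nat.le_add_right r i))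
  have hupper : P.map X (Set.Ioi (r + i)) = 0 := by
    by_contra hne
    have hpos := (h.isPearsonLaw.weight_mul_density_pos_iff (r + i)).2
      ⟨hlower, pos_iff_ne_zero.2 hne⟩
    rw [Nat.cast_add, hzero, zero_mul] at hpos
    exact hpos.false
  rw [Measure.map_apply_of_aemeasurable h.aemeasurable measurableSet_Ioi] at hupper
  filter_upwards [measure_eq_zero_iff_ae_notMem.1 hupper] with ω hω
  exact (not_lt.1 hω).trans_lt (Nat.add_lt_add_left (Finset.mem_range.1 hi) r)

theorem exists_finset_of_integral_eq_zero (h : IsDiscrete P X δ β γ)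
    (hmgf : FiniteMGFNearZero (fun ω => (X ω : ℝ)) P) {k : ℕ}
    (hk : ∫ ω, ascQuad δ β γ k (X ω) ∂P = 0) :
    ∃ s : Finset ℝ, s.card = k ∧ ∀ᵐ ω ∂P, (X ω : ℝ) ∈ s := by
  classical
  obtain ⟨r, hr, hmin⟩ : ∃ r, 0 < P.real {ω | X ω = r} ∧
      ∀ n, 0 < P.real {ω | X ω = n} → r ≤ n := by
    have hex : ∃ r, 0 < P.real {ω | X ω = r} := by
      by_contra! hzero
      have hfalse : ∀ᵐ _ ∂P, False :=
        ae_comp_iff_forall_pos (X := X) (p := fun _ => False).2 fun n hn => (hzero n).not_gt hn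
      simpa using hfalse.exists
    exact ⟨Nat.find hex, Nat.find_spec hex, fun _ => Nat.find_min' hex⟩
  have hzero : ∀ᵐ ω ∂P, ascQuad δ β γ k (X ω) = 0 :=
    (integral_eq_zero_iff_of_nonneg_ae (h.ascQuad_nonneg k) (integrable_ascQuad hmgf k)).1 hk
  have hmax := h.ae_lt_of_ascQuad_eq_zero hr
    (ae_comp_iff_forall_pos (p := fun n : ℕ => ascQuad δ β γ k n = 0).1 hzero _ hr)
  refine ⟨(Finset.Ico r (r + k)).map Nat.castEmbedding, by simp, ?_⟩
  filter_upwards [ae_comp_iff_forall_pos.2 hmin, hmax] with ω hrω hωk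
  simp [hrω, hωk]

theorem isPearsonSystem (h : IsDiscrete P X δ β γ)
    (hmgf : FiniteMGFNearZero (fun ω => (X ω : ℝ)) P) :
    IsPearsonSystem P (fun ω => (X ω : ℝ)) 1 (∫ ω, (X ω : ℝ) ∂P) δ (fwdDiffOp (quadPoly δ β γ))
      (fun k => ∫ ω, ascQuad δ β γ k (X ω) ∂P) where
  mgf := hmgf.zero_mem_interior
  isRaising := isRaising_fwdDiffOp δ β γ
  exists_chain u := by
    let Δ : ℝ[X] → ℝ[X] := fun v => taylor 1 v - v
    refine ⟨fun j => ascPoly δ β γ j * Δ^[j] u, by simp [ascPoly], ?_, fun k hk => ?_⟩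
    · have hchain := h.isSteinChain (D := fun j n => (Δ^[j] u).eval (n : ℝ)) fun j n => by
        simp only [Function.iterate_succ_apply', Δ, eval_sub, taylor_eval, Nat.cast_add_one]
      simpa only [eval_mul, eval_ascPoly] using hchain
    · have hconst : Δ^[k] u = C (k.factorial * u.coeff k) :=
        HasTopCoeff.iterate_eq_C (fun p d c hp => by simpa only [one_mul] using hp.taylor_sub 1) k
          (.of_natDegree_le hk)
      simp only [hconst, eval_mul, eval_C, eval_ascPoly, integral_mul_const]
      ring
  nonneg k := integral_nonneg_of_ae (h.ascQuad_nonneg k)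
  finite_support k hk := h.exists_finset_of_integral_eq_zero hmgf hk
  bounded_of_neg hδ := by
    obtain ⟨R, hR⟩ := exists_abs_le_of_quad_nonneg (β := β) (γ := γ) hδ
    exact ⟨R, (h.ascQuad_nonneg 1).mono fun ω hω => hR _ (by simpa [ascQuad] using hω)⟩

theorem hasSum_covariance (h : IsDiscrete P X δ β γ)
    (hmgf : FiniteMGFNearZero (fun ω => (X ω : ℝ)) P) {g₁ g₂ : ℕ → ℝ}
    (hL₁ : MemLp g₁ 2 (P.map X)) (hL₂ : MemLp g₂ 2 (P.map X))
    (hI₁ : ∀ k, Integrable (fun ω => ascQuad δ β γ k (X ω) * |(fwdDiff 1)^[k] g₁ (X ω)|) P)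
    (hI₂ : ∀ k, Integrable (fun ω => ascQuad δ β γ k (X ω) * |(fwdDiff 1)^[k] g₂ (X ω)|) P) :
    HasSum (fun n => (∫ ω, ascQuad δ β γ (n + 1) (X ω) * (fwdDiff 1)^[n + 1] g₁ (X ω) ∂P) *
        (∫ ω, ascQuad δ β γ (n + 1) (X ω) * (fwdDiff 1)^[n + 1] g₂ (X ω) ∂P) /
        ((n + 1).factorial * (∫ ω, ascQuad δ β γ (n + 1) (X ω) ∂P) *
          ∏ j ∈ Finset.Icc n (2 * n), (1 - (j : ℝ) * δ)))
      (cov[fun ω => g₁ (X ω), fun ω => g₂ (X ω); P]) := by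
  have hdiff : ∀ (g : ℕ → ℝ) (j n : ℕ),
      (fwdDiff 1)^[j + 1] g n = (fwdDiff 1)^[j] g (n + 1) - (fwdDiff 1)^[j] g n := fun g j n => by
    rw [Function.iterate_succ_apply', fwdDiff]
  have hsum := (h.isPearsonSystem hmgf).hasSum_covariance (h.memLp_floor hL₁) (h.memLp_floor hL₂)
    (h.isSteinChain (hdiff g₁)) (h.isSteinChain (hdiff g₂))
    (fun ω => by simp [ascQuad]) (fun ω => by simp [ascQuad])
    (fun k => h.integrable_ascQuad_mul (hI₁ k)) (fun k => h.integrable_ascQuad_mul (hI₂ k))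
  simpa only [Nat.floor_natCast] using hsum

end IsDiscrete

end Discrete

end Pearson

theorem theorem5p2 {Ω : Type*} [MeasurableSpace Ω] (P : Measure Ω) [IsProbabilityMeasure P] :
    (∀ (X : Ω → ℝ) (f : ℝ → ℝ) (δ β γ : ℝ), Pearson.IsContinuous P X f δ β γ →
      Pearson.FiniteMGFNearZero X P →
      ∀ g₁ g₂ : ℝ → ℝ,
        MemLp g₁ 2 (P.map X) → MemLp g₂ 2 (P.map X) →
        ContDiffOn ℝ ((⊤ : ℕ∞) : WithTop ℕ∞) g₁ (Pearson.openSupport f) →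
        ContDiffOn ℝ ((⊤ : ℕ∞) : WithTop ℕ∞) g₂ (Pearson.openSupport f) →
        (∀ k : ℕ, Integrable
          (fun ω => Pearson.quad δ β γ (X ω) ^ k * |iteratedDeriv k g₁ (X ω)|) P) →
        (∀ k : ℕ, Integrable
          (fun ω => Pearson.quad δ β γ (X ω) ^ k * |iteratedDeriv k g₂ (X ω)|) P) →
        HasSum
          (fun n : ℕ =>
            let k := n + 1
            ((∫ ω, Pearson.quad δ β γ (X ω) ^ k * iteratedDeriv k g₁ (X ω) ∂P) *
              (∫ ω, Pearson.quad δ β γ (X ω) ^ k * iteratedDeriv k g₂ (X ω) ∂P)) /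
            ((k.factorial : ℝ) * (∫ ω, Pearson.quad δ β γ (X ω) ^ k ∂P) *
              ∏ j ∈ Finset.Icc (k - 1) (2 * k - 2), (1 - (j : ℝ) * δ)))
          (covariance (fun ω => g₁ (X ω)) (fun ω => g₂ (X ω)) P)) ∧
    (∀ (X : Ω → ℕ) (δ β γ : ℝ), Pearson.IsDiscrete P X δ β γ →
      Pearson.FiniteMGFNearZero (fun ω => (X ω : ℝ)) P →
      ∀ g₁ g₂ : ℕ → ℝ,
        MemLp g₁ 2 (P.map X) → MemLp g₂ 2 (P.map X) →
        (∀ k : ℕ, Integrable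
          (fun ω => Pearson.ascQuad δ β γ k (X ω) * |(fwdDiff 1)^[k] g₁ (X ω)|) P) →
        (∀ k : ℕ, Integrable
          (fun ω => Pearson.ascQuad δ β γ k (X ω) * |(fwdDiff 1)^[k] g₂ (X ω)|) P) →
        HasSum
          (fun n : ℕ =>
            let k := n + 1
            if (∫ ω, Pearson.ascQuad δ β γ k (X ω) ∂P) = 0 then 0
            else
              ((∫ ω, Pearson.ascQuad δ β γ k (X ω) * (fwdDiff 1)^[k] g₁ (X ω) ∂P) *
                (∫ ω, Pearson.ascQuad δ β γ k (X ω) * (fwdDiff 1)^[k] g₂ (X ω) ∂P)) /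
              ((k.factorial : ℝ) * (∫ ω, Pearson.ascQuad δ β γ k (X ω) ∂P) *
                ∏ j ∈ Finset.Icc (k - 1) (2 * k - 2), (1 - (j : ℝ) * δ)))
          (covariance (fun ω => g₁ (X ω)) (fun ω => g₂ (X ω)) P)) := by
  refine ⟨fun X f δ β γ h hmgf g₁ g₂ hL₁ hL₂ hs₁ hs₂ hI₁ hI₂ => ?_,
    fun X δ β γ h hmgf g₁ g₂ hL₁ hL₂ hI₁ hI₂ => ?_⟩
  · exact h.hasSum_covariance hmgf hL₁ hL₂ hs₁ hs₂ hI₁ hI₂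
  · convert h.hasSum_covariance hmgf hL₁ hL₂ hI₁ hI₂ using 2 with i
    simp only [Nat.add_sub_cancel, show 2 * (i + 1) - 2 = 2 * i by omega]
    split_ifs with h0
    · rw [h0]; simp
    · rfl
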